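/- Let $m>1$ be a squarefree integer, $K=\mathbb{Q}(\sqrt m)$, $\varepsilon$ a fundamental unit of $K$, and $p$ a prime number dividing the discriminant $D_K$; let $\mathfrak p$ be the prime ideal of $K$ above $p$, with its valuation $v_{\mathfrak p}$ normalized so that its value group is $\mathbb{Z}$, and let $v_p$ be the $p$-adic valuation of $\mathbb{Q}$. Definitions. Let $U_K=\bigoplus_{\mathfrak q\mid p}U^1_{\mathfrak q}$ be the group of principal local units of the completions $K_{\mathfrak q}$, and let $\overline E_K$ be the closure in $U_K$ of the diagonal image of the group $E_K$ of units of $K$ congruent to $1$ modulo $\prod_{\mathfrak q\mid p}\mathfrak q$. Let $\log_p$ be the $p$-adic logarithm, given by the usual series on principal units and extended to all units $u$ of the valuation ring of $K_{\mathfrak q}$ by $\log_p(u)=\frac{1}{N\mathfrak q-1}\log_p(u^{N\mathfrak q-1})$. The normalized $p$-adic regulator is $$\mathcal R_K:=\mathrm{tor}_{\mathbb{Z}_p}\big(\log_p(U_K)/\log_p(\overline E_K)\big).$$ For $a,b\in K_{\mathfrak p}$ write $a\sim b$ if $a=ub$ for a unit $u$ of the valuation ring of $K_{\mathfrak p}$.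 Then $\mathcal R_K$ is finite, and its order $\#\mathcal R_K$ is given as follows. (i) If $p\nmid 6$, then $\#\mathcal R_K\sim\frac{1}{\sqrt m}\log_p(\varepsilon)$, and $v_{\mathfrak p}(\varepsilon^{p-1}-1)=1+2\delta$ with an integer $\delta\ge 0$, for which $v_p(\#\mathcal R_K)=\delta$. (ii) If $p=3$, then $\#\mathcal R_K\sim\frac{1}{\sqrt m}\log_3(\varepsilon)$ if $m\not\equiv-3\pmod 9$, and $\#\mathcal R_K\sim\frac{1}{3\sqrt m}\log_3(\varepsilon)$ if $m\equiv-3\pmod 9$. Moreover $$v_3(\#\mathcal R_K)=\frac{v_{\mathfrak p}(\varepsilon^6-1)-2-\delta}{2},$$ where $\delta=1$ if $m\not\equiv-3\pmod 9$ and $\delta=3$ if $m\equiv-3\pmod 9$. (iii) If $p=2$, then $\#\mathcal R_K\sim\frac{\log_2(\varepsilon)}{\sqrt m}$ if $m\equiv2\pmod 8$, $\#\mathcal R_K\sim\frac{\log_2(\varepsilon)}{2\sqrt m}$ if $m\equiv3$ or $6\pmod 8$, and $\#\mathcal R_K\sim\frac{\log_2(\varepsilon)}{4}$ if $m\equiv7\pmod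 8$. Moreover $$v_2(\#\mathcal R_K)=\frac{v_{\mathfrak p}(\varepsilon^4-1)-4-\delta}{2},$$ where $\delta=1,2,3,4$ if $m\equiv2,3,6,7\pmod 8$, respectively. -/

import Mathlib

open NumberField IsDedekindDomain

namespace PadicRegulator

noncomputable section

/-- The set of prime ideals `𝔭 ∣ p` of the number field `K`. -/
abbrev PrimesAbove (K : Type*) [Field K] [NumberField K] (p : ℕ) : Type _ :=
  {𝔭 : HeightOneSpectrum (𝓞 K) // (p : 𝓞 K) ∈ 𝔭.asIdeal}

/-- The product `∏_{𝔭 ∣ p} K_𝔭` of the completions of `K` at the primes above `p`,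
with its product topology. -/
abbrev LocalAlgebra (K : Type*) [Field K] [NumberField K] (p : ℕ) : Type _ :=
  (𝔭 : PrimesAbove K p) → 𝔭.1.adicCompletion K

/-- The `p`-adic logarithm on principal units of `K_𝔭`, given by the series
`log x = ∑_{n ≥ 1} (-1)^(n-1) (x - 1)^n / n`. -/
def principalLog {K : Type*} [Field K] [NumberField K] (𝔭 : HeightOneSpectrum (𝓞 K))
    (x : 𝔭.adicCompletion K) : 𝔭.adicCompletion K :=
  ∑' n : ℕ, (-1) ^ n * (x - 1) ^ (n + 1) / ((n + 1 : ℕ) : 𝔭.adicCompletion K)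

/-- The `p`-adic logarithm on all units of the valuation ring of `K_𝔭`: if `x` is a unit, then
`x ^ (N𝔭 - 1)` is a principal unit and `log x = log (x ^ (N𝔭 - 1)) / (N𝔭 - 1)`. -/
def unitLog {K : Type*} [Field K] [NumberField K] (𝔭 : HeightOneSpectrum (𝓞 K))
    (x : 𝔭.adicCompletion K) : 𝔭.adicCompletion K :=
  principalLog 𝔭 (x ^ (Ideal.absNorm 𝔭.asIdeal - 1)) /
    ((Ideal.absNorm 𝔭.asIdeal - 1 : ℕ) : 𝔭.adicCompletion K)

/-- `U_K = ⨁_{𝔭 ∣ p} U_𝔭¹`, the group of principal local units, as a subset of `∏ K_𝔭`. -/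
def principalUnits (K : Type*) [Field K] [NumberField K] (p : ℕ) : Set (LocalAlgebra K p) :=
  {u | ∀ 𝔭, Valued.v (u 𝔭 - 1) < 1}

/-- `E_K`, the group of global units congruent to `1` modulo every prime above `p`. -/
def principalGlobalUnits (K : Type*) [Field K] [NumberField K] (p : ℕ) : Set (𝓞 K)ˣ :=
  {e | ∀ 𝔭 : PrimesAbove K p, (e : 𝓞 K) - 1 ∈ 𝔭.1.asIdeal}

/-- The diagonal embedding of `E_K` into `∏ K_𝔭`. -/
def diagonal (K : Type*) [Field K] [NumberField K] (p : ℕ) (e : (𝓞 K)ˣ) : LocalAlgebra K p :=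
  fun 𝔭 => algebraMap K (𝔭.1.adicCompletion K) ((e : 𝓞 K) : K)

/-- The closure of the diagonal image of `E_K`. It is taken in `∏ K_𝔭`, in which `U_K` is
closed, so that it is the closure in `U_K`. -/
def globalUnitsClosure (K : Type*) [Field K] [NumberField K] (p : ℕ) : Set (LocalAlgebra K p) :=
  closure (diagonal K p '' principalGlobalUnits K p)

/-- The logarithm on `U_K`, component by component. -/
def logMap (K : Type*) [Field K] [NumberField K] (p : ℕ) (u : LocalAlgebra K p) :
    LocalAlgebra K p :=
  fun 𝔭 => principalLog 𝔭.1 (u 𝔭)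

/-- The group `log U_K`. (The logarithm is a homomorphism on `U_K`, so the image is a group and
taking the generated subgroup adds nothing; it only makes the group structure available.) -/
def logUnits (K : Type*) [Field K] [NumberField K] (p : ℕ) : AddSubgroup (LocalAlgebra K p) :=
  AddSubgroup.closure (logMap K p '' principalUnits K p)

/-- The group `log (closure of E_K)`; the remark on `logUnits` applies. -/
def logGlobalUnits (K : Type*) [Field K] [NumberField K] (p : ℕ) :
    AddSubgroup (LocalAlgebra K p) :=
  AddSubgroup.closure (logMap K p '' globalUnitsClosure K p)

/-- The normalized `p`-adic regulator: the torsion of `log U_K / log (closure of E_K)`.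
(In a `ℤ_p`-module the elements killed by a nonzero element of `ℤ_p` are those killed by a power
of `p`, which are those killed by a positive integer.) -/
abbrev NormalizedRegulator (K : Type*) [Field K] [NumberField K] (p : ℕ) : Type _ :=
  AddCommGroup.torsion (logUnits K p ⧸ (logGlobalUnits K p).addSubgroupOf (logUnits K p))

/-- `#R_K`, the order of the normalized `p`-adic regulator. -/
def regulatorOrder (K : Type*) [Field K] [NumberField K] (p : ℕ) : ℕ :=
  Nat.card (NormalizedRegulator K p)

/-- `a ∼ b` for `a b : K_𝔭`: equality up to a `p`-adic unit, that is, up to a unit of the valuation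
ring of `K_𝔭`. -/
def PadicAssociated {K : Type*} [Field K] [NumberField K] (𝔭 : HeightOneSpectrum (𝓞 K))
    (a b : 𝔭.adicCompletion K) : Prop :=
  ∃ u : (𝔭.adicCompletionIntegers K)ˣ, a = ((u : 𝔭.adicCompletionIntegers K) : 𝔭.adicCompletion K) * b

/-- `v_𝔭(x) = n` for `x : K` (so in particular `x ≠ 0`), `v_𝔭` having value group `ℤ`. -/
def HasOrd {K : Type*} [Field K] [NumberField K] (𝔭 : HeightOneSpectrum (𝓞 K))
    (x : K) (n : ℤ) : Prop :=
  𝔭.valuation K x = WithZero.exp (-n)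

/-- `ε` is a fundamental unit of a field with unit group `{± ε ^ n}`. -/
def IsFundamentalUnit {K : Type*} [Field K] [NumberField K] (ε : (𝓞 K)ˣ) : Prop :=
  ∀ u : (𝓞 K)ˣ, ∃ n : ℤ, u = ε ^ n ∨ u = -ε ^ n

end

end PadicRegulator

/-! A prime p dividing D_K has a single prime 𝔭 above it, of norm p and ramification index 2.
Everything therefore happens in L = K_𝔭, normed so that a uniformizer has norm p⁻¹; then ℚ_p sits in
L with its norm squared.

The logarithm is handled as lim (x^(p^k) - 1)/p^k, from which additivity is immediate. On the disc
of radius ρ about 1 it is an isometry onto the disc of radius ρ about 0, where ρ = p⁻¹, 3⁻², 2⁻³ for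
p ≥ 5, p = 3, p = 2.

Up to sign every unit is a power of ε, so the closure of E_K has logarithms ℤ_p log(ε^(p-1))
(`logSeries_image_closure_localGlobalUnits`). This generator is nonzero because Pell's equation has
a nontrivial solution, and it lies on the line ℚ_p √m because ε² has norm 1. Torsion classes are
therefore represented by elements of log U ∩ ℚ_p √m. If this intersection is ℤ_p k√m and
log(ε^(p-1)) = b k√m, then the regulator is ℤ_p / bℤ_p (`card_torsion_quotient`,
`regulatorOrder_of_lattice`), so its order is associated to log(ε)/(k√m).

What remains is to find k. For p ≥ 5 the disc is the whole group of principal units and k = 1.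
Otherwise U is generated by the disc, one unit g (1 + √m or √m) and, for p = 2, the sign -1
(`mem_logSeries_image_iff`). A cube or fourth power of g falls into the disc and yields log g modulo
the disc. The outcome is k = 1 or 3 for p = 3, and k = 1, 2, 2, 4 for m ≡ 2, 3, 6, 7 mod 8.

For the valuations, ε^((p-1)j) lies in the disc for j = 1, 3, 4 respectively; there the isometry
identifies the order of ε^((p-1)j) - 1 with that of j log(ε^(p-1)) (`regulatorOrder_summary`). -/

namespace PadicRegulator

open Filter Topology

/-! ### Embedding ℚ_p into a ramified quadratic extension -/

section Embedding

variable {p : ℕ} [Fact p.Prime] {L : Type*} [NormedField L] [IsUltrametricDist L]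

lemma norm_natCast_eq_one_of_not_dvd (hp : ‖(p : L)‖ < 1) {n : ℕ} (hn : ¬ p ∣ n) :
    ‖(n : L)‖ = 1 := by
  have hcop : IsCoprime (n : ℤ) (p : ℤ) :=
    Nat.isCoprime_iff_coprime.2 ((Nat.Prime.coprime_iff_not_dvd Fact.out).2 hn).symm
  obtain ⟨a, b, hab⟩ := hcop
  refine le_antisymm (IsUltrametricDist.norm_natCast_le_one L n) ?_
  by_contra! h
  have h1 : (a : L) * n + b * p = 1 := by exact_mod_cast congrArg (Int.cast : ℤ → L) hab
  have h2 : ‖(a : L) * n + b * p‖ < 1 := by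
    refine (IsUltrametricDist.norm_add_le_max _ _).trans_lt (max_lt ?_ ?_)
    · rw [norm_mul]
      exact (mul_le_of_le_one_left (norm_nonneg _)
        (IsUltrametricDist.norm_intCast_le_one L a)).trans_lt h
    · rw [norm_mul]
      exact (mul_le_of_le_one_left (norm_nonneg _)
        (IsUltrametricDist.norm_intCast_le_one L b)).trans_lt hp
  rw [h1, norm_one] at h2
  exact lt_irrefl _ h2

lemma inv_prime_pos : (0 : ℝ) < (p : ℝ)⁻¹ :=
  inv_pos.2 (Nat.cast_pos.2 (Nat.Prime.pos Fact.out))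

lemma inv_prime_lt_one : (p : ℝ)⁻¹ < 1 :=
  inv_lt_one_of_one_lt₀ (Nat.one_lt_cast.2 (Nat.Prime.one_lt Fact.out))

omit [IsUltrametricDist L] in
lemma norm_prime_lt_one (hp : ‖(p : L)‖ = (p : ℝ)⁻¹ ^ 2) : ‖(p : L)‖ < 1 :=
  hp ▸ pow_lt_one₀ inv_prime_pos.le inv_prime_lt_one two_ne_zero

/-- The exponent 2 is the ramification index: the norm of L is normalized by a uniformizer and not
by p. -/
lemma norm_natCast_eq (hp : ‖(p : L)‖ = (p : ℝ)⁻¹ ^ 2) (n : ℕ) :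
    ‖(n : L)‖ = ‖(n : ℚ_[p])‖ ^ 2 := by
  rcases eq_or_ne n 0 with rfl | hn
  · simp
  obtain ⟨a, m, hm, rfl⟩ := Nat.exists_eq_pow_mul_and_not_dvd hn p (Nat.Prime.ne_one Fact.out)
  have h1 := norm_natCast_eq_one_of_not_dvd (norm_prime_lt_one hp) hm
  have h2 := norm_natCast_eq_one_of_not_dvd (L := ℚ_[p]) Padic.norm_p_lt_one hm
  push_cast
  rw [norm_mul, norm_mul, h1, h2, norm_pow, norm_pow, hp, Padic.norm_p]
  ring

lemma norm_intCast_eq (hp : ‖(p : L)‖ = (p : ℝ)⁻¹ ^ 2) (n : ℤ) :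
    ‖(n : L)‖ = ‖(n : ℚ_[p])‖ ^ 2 := by
  obtain ⟨k, rfl | rfl⟩ := Int.eq_nat_or_neg n
  · simpa using norm_natCast_eq hp k
  · simpa using norm_natCast_eq hp k

lemma norm_ratCast_eq (hp : ‖(p : L)‖ = (p : ℝ)⁻¹ ^ 2) (r : ℚ) :
    ‖(r : L)‖ = ‖(r : ℚ_[p])‖ ^ 2 := by
  rw [Rat.cast_def, Rat.cast_def, norm_div, norm_div, norm_intCast_eq hp, norm_natCast_eq hp,
    div_pow]

variable [CharZero L] [CompleteSpace L]

omit [CompleteSpace L] in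
-- Distances of rationals in L are the squares of their p-adic distances, and t² → 0 with t.
lemma uniformContinuous_ratCast (hp : ‖(p : L)‖ = (p : ℝ)⁻¹ ^ 2) :
    UniformContinuous ((Rat.castHom L).comp (WithVal.equiv (Rat.padicValuation p)).toRingHom) := by
  have h := (Padic.isUniformInducing_cast_withVal (p := p)).comap_uniformity
  rw [UniformContinuous, ← h, Metric.uniformity_eq_comap_nhds_zero,
    Metric.uniformity_eq_comap_nhds_zero, tendsto_comap_iff, comap_comap]
  have key : ((fun x : L × L => dist x.1 x.2) ∘ fun x : WithVal (Rat.padicValuation p) ×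
      WithVal (Rat.padicValuation p) =>
        (((Rat.castHom L).comp (WithVal.equiv (Rat.padicValuation p)).toRingHom) x.1,
        ((Rat.castHom L).comp (WithVal.equiv (Rat.padicValuation p)).toRingHom) x.2)) =
      (fun t : ℝ => t ^ 2) ∘ ((fun x : ℚ_[p] × ℚ_[p] => dist x.1 x.2) ∘
        fun x : WithVal (Rat.padicValuation p) × WithVal (Rat.padicValuation p) =>
        (((Rat.castHom ℚ_[p]).comp (WithVal.equiv (Rat.padicValuation p)).toRingHom) x.1,
        ((Rat.castHom ℚ_[p]).comp (WithVal.equiv (Rat.padicValuation p)).toRingHom) x.2)) := by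
    funext x
    have := norm_ratCast_eq hp (WithVal.equiv (Rat.padicValuation p) x.1 -
      WithVal.equiv (Rat.padicValuation p) x.2)
    push_cast at this
    simpa [dist_eq_norm_sub] using this
  rw [key]
  refine Tendsto.comp ?_ tendsto_comap
  simpa using (continuous_pow 2).tendsto (0 : ℝ)

/-- The embedding `ℚ_p → L` of the completion of `ℚ` into a complete field in which `p` has
absolute value `p⁻²`. -/
noncomputable def padicEmbedding (hp : ‖(p : L)‖ = (p : ℝ)⁻¹ ^ 2) : ℚ_[p] →+* L :=
  IsDenseInducing.extendRingHom Padic.isUniformInducing_cast_withVal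
    Padic.isDenseInducing_cast_withVal.dense (uniformContinuous_ratCast hp)

lemma continuous_padicEmbedding (hp : ‖(p : L)‖ = (p : ℝ)⁻¹ ^ 2) :
    Continuous (padicEmbedding hp) :=
  (uniformContinuous_uniformly_extend Padic.isUniformInducing_cast_withVal
    Padic.isDenseInducing_cast_withVal.dense (uniformContinuous_ratCast hp)).continuous

lemma norm_padicEmbedding (hp : ‖(p : L)‖ = (p : ℝ)⁻¹ ^ 2) (x : ℚ_[p]) :
    ‖padicEmbedding hp x‖ = ‖x‖ ^ 2 := by
  induction x using isClosed_property (Padic.denseRange_ratCast p)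
  · exact isClosed_eq (continuous_padicEmbedding hp).norm (by fun_prop)
  · rw [map_ratCast, norm_ratCast_eq hp]

/-- Squaring distances preserves the uniform structure, so the image is complete. This keeps limits
of rational coefficients inside ℚ_p. -/
lemma isClosed_range_padicEmbedding (hp : ‖(p : L)‖ = (p : ℝ)⁻¹ ^ 2) :
    IsClosed (Set.range (padicEmbedding hp)) := by
  have h : ∀ x y, dist (padicEmbedding hp x) (padicEmbedding hp y) = dist x y ^ 2 := fun x y => by
    rw [dist_eq_norm_sub, dist_eq_norm_sub, ← map_sub, norm_padicEmbedding]
  have hu : IsUniformInducing (padicEmbedding hp) := by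
    refine Metric.isUniformInducing_iff.2 ⟨?_, fun δ hδ => ⟨δ ^ 2, by positivity, fun {a b} hab => ?_⟩⟩
    -- The bound 1 in the minimum gives t² ≤ t < ε.
    · refine Metric.uniformContinuous_iff.2 fun ε hε => ⟨min ε 1, by positivity, fun {a b} hab => ?_⟩
      rw [h]
      have h1 := hab.trans_le (min_le_left _ _)
      have h2 := hab.trans_le (min_le_right _ _)
      nlinarith [dist_nonneg (x := a) (y := b)]
    · rw [h] at hab
      exact lt_of_pow_lt_pow_left₀ 2 hδ.le hab
  exact hu.isComplete_range.isClosed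

end Embedding

/-! ### The logarithm as a limit, and its additivity -/

section Logarithm

variable {p : ℕ} [Fact p.Prime] {L : Type*} [NormedField L] [IsUltrametricDist L]

/-- The logarithm series `∑_{n ≥ 1} (-1)^(n-1) (x - 1)^n / n`. -/
noncomputable def logSeries (x : L) : L :=
  ∑' n : ℕ, (-1) ^ n * (x - 1) ^ (n + 1) / ((n + 1 : ℕ) : L)

lemma inv_le_norm_natCast {n : ℕ} (hn : n ≠ 0) : (n : ℝ)⁻¹ ≤ ‖(n : ℚ_[p])‖ := by
  obtain ⟨a, m, hm, rfl⟩ := Nat.exists_eq_pow_mul_and_not_dvd hn p (Nat.Prime.ne_one Fact.out)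
  have h2 := norm_natCast_eq_one_of_not_dvd (L := ℚ_[p]) Padic.norm_p_lt_one hm
  have hm1 : 1 ≤ m := Nat.one_le_iff_ne_zero.2 fun h => hm (h ▸ dvd_zero p)
  push_cast
  rw [norm_mul, h2, norm_pow, Padic.norm_p, mul_inv, mul_one, inv_pow]
  exact mul_le_of_le_one_right (by positivity) (inv_le_one_of_one_le₀ (by exact_mod_cast hm1))

/-- Ultrametric dominated convergence: the dominating sequence need only tend to 0, since that
already makes series summable. -/
lemma tendsto_tsum_of_dominated [CompleteSpace L] {f : ℕ → ℕ → L} {g : ℕ → L} {b : ℕ → ℝ}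
    (hb : Tendsto b atTop (𝓝 0)) (hf : ∀ k j, ‖f k j‖ ≤ b j)
    (h : ∀ j, Tendsto (fun k => f k j) atTop (𝓝 (g j))) :
    Tendsto (fun k => ∑' j, f k j) atTop (𝓝 (∑' j, g j)) := by
  have hg : ∀ j, ‖g j‖ ≤ b j := fun j =>
    le_of_tendsto (h j).norm (Eventually.of_forall fun k => hf k j)
  have hsum : ∀ {u : ℕ → L}, (∀ j, ‖u j‖ ≤ b j) → Summable u := fun {u} hu => by
    refine NonarchimedeanAddGroup.summable_of_tendsto_cofinite_zero ?_
    rw [Nat.cofinite_eq_atTop]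
    exact squeeze_zero_norm hu hb
  rw [Metric.tendsto_atTop']
  intro ε hε
  -- Terms from J on are small uniformly in k; the finitely many earlier ones are small for large k.
  -- The supremum, not the sum, of the errors counts.
  obtain ⟨J, hJ⟩ := (hb.eventually (gt_mem_nhds (half_pos hε))).exists_forall_of_atTop
  have hev : ∀ᶠ k in atTop, ∀ j ∈ Finset.range J, ‖f k j - g j‖ < ε / 2 := by
    rw [eventually_all_finset]
    intro j _
    have := (Metric.tendsto_nhds.1 (h j)) (ε / 2) (half_pos hε)
    simpa only [dist_eq_norm_sub] using this
  obtain ⟨N, hN⟩ := hev.exists_forall_of_atTop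
  refine ⟨N, fun k hk => ?_⟩
  rw [dist_eq_norm_sub, ← (hsum (hf k)).tsum_sub (hsum hg)]
  refine (IsUltrametricDist.norm_tsum_le_of_forall_le_of_nonneg (half_pos hε).le fun j => ?_).trans_lt
    (half_lt_self hε)
  by_cases hj : j < J
  · exact (hN k hk.le j (Finset.mem_range.2 hj)).le
  · have := (hJ j (not_lt.1 hj)).le
    rw [sub_eq_add_neg]
    refine (IsUltrametricDist.norm_add_le_max _ _).trans (max_le ((hf k j).trans this) ?_)
    rw [norm_neg]
    exact (hg j).trans this

variable [CharZero L]

omit [CharZero L] in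
lemma norm_pow_div_le (hp : ‖(p : L)‖ = (p : ℝ)⁻¹ ^ 2) (y : L) (j : ℕ) :
    ‖y ^ (j + 1) / ((j + 1 : ℕ) : L)‖ ≤ ((j + 1 : ℕ) : ℝ) ^ 2 * ‖y‖ ^ (j + 1) := by
  rw [norm_div, norm_pow, norm_natCast_eq hp, div_eq_mul_inv, mul_comm]
  gcongr
  rw [← inv_pow]
  gcongr
  exact inv_le_of_inv_le₀ (by positivity) (inv_le_norm_natCast (Nat.succ_ne_zero j))

omit [IsUltrametricDist L] [CharZero L] in
lemma tendsto_norm_bound {y : L} (hy : ‖y‖ < 1) :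
    Tendsto (fun j : ℕ => ((j + 1 : ℕ) : ℝ) ^ 2 * ‖y‖ ^ (j + 1)) atTop (𝓝 0) :=
  (tendsto_add_atTop_iff_nat (f := fun j : ℕ => (j : ℝ) ^ 2 * ‖y‖ ^ j) 1).2
    (tendsto_pow_const_mul_const_pow_of_abs_lt_one 2 (by rwa [abs_norm]))

omit [IsUltrametricDist L] [CharZero L] in
lemma tendsto_prime_pow (hp : ‖(p : L)‖ = (p : ℝ)⁻¹ ^ 2) :
    Tendsto (fun k => (p : L) ^ k) atTop (𝓝 0) :=
  tendsto_pow_atTop_nhds_zero_of_norm_lt_one (norm_prime_lt_one hp)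

/-- As p^k → 0, the coefficient C(p^k - 1, j) tends to C(-1, j) = (-1)^j. The induction uses C(N -
1, j + 1) = N/(j + 1) · C(N - 1, j) - C(N - 1, j). -/
lemma tendsto_choose_prime_pow_sub_one (hp : ‖(p : L)‖ = (p : ℝ)⁻¹ ^ 2) (j : ℕ) :
    Tendsto (fun k => ((p ^ k - 1).choose j : L)) atTop (𝓝 ((-1) ^ j)) := by
  induction j with
  | zero => simp
  | succ j ih =>
    have hid : ∀ k, ((p ^ k - 1).choose (j + 1) : L) =
        (p : L) ^ k * ((p ^ k - 1).choose j : L) / (j + 1 : ℕ) - ((p ^ k - 1).choose j : L) := by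
      intro k
      have hpos : p ^ k - 1 + 1 = p ^ k :=
        Nat.sub_add_cancel (Nat.one_le_pow _ _ (Nat.Prime.pos Fact.out))
      have h1 := Nat.add_one_mul_choose_eq (p ^ k - 1) j
      have h2 := Nat.choose_succ_succ' (p ^ k - 1) j
      rw [hpos] at h1 h2
      rw [h2] at h1
      have h3 : ((j + 1 : ℕ) : L) ≠ 0 := Nat.cast_ne_zero.2 (Nat.succ_ne_zero j)
      rw [eq_sub_iff_add_eq, eq_div_iff h3]
      rw [add_comm]
      exact_mod_cast h1.symm
    simp_rw [hid]
    have := (((tendsto_prime_pow hp).mul ih).div_const ((j + 1 : ℕ) : L)).sub ih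
    simpa [pow_succ] using this

omit [IsUltrametricDist L] in
-- The binomial theorem with C(N, j + 1)/N = C(N - 1, j)/(j + 1), written so as to be compared with
-- the logarithm term by term. The sum is finite because C(N - 1, j) vanishes for j ≥ N.
lemma pow_sub_one_div_eq_tsum (x : L) {N : ℕ} (hN : N ≠ 0) :
    (x ^ N - 1) / (N : L) =
      ∑' j : ℕ, ((N - 1).choose j : L) * ((x - 1) ^ (j + 1) / ((j + 1 : ℕ) : L)) := by
  rw [tsum_eq_sum (s := Finset.range N) fun j hj => by
    rw [Nat.choose_eq_zero_of_lt (by rw [Finset.mem_range] at hj; lia)]; simp]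
  have hN' : (N : L) ≠ 0 := Nat.cast_ne_zero.2 hN
  rw [div_eq_iff hN', Finset.sum_mul]
  have hx : x ^ N = ((x - 1) + 1) ^ N := by ring
  rw [hx, add_pow, Finset.sum_range_succ']
  simp only [one_pow, mul_one, pow_zero, Nat.choose_zero_right, Nat.cast_one, add_sub_cancel_right]
  refine Finset.sum_congr rfl fun j _ => ?_
  have h1 := Nat.add_one_mul_choose_eq (N - 1) j
  rw [Nat.sub_add_cancel (Nat.one_le_iff_ne_zero.2 hN)] at h1
  have h2 : (N : L) * ((N - 1).choose j : L) = (N.choose (j + 1) : L) * ((j + 1 : ℕ) : L) := by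
    exact_mod_cast h1
  have h3 : ((j + 1 : ℕ) : L) ≠ 0 := Nat.cast_ne_zero.2 (Nat.succ_ne_zero j)
  field_simp
  linear_combination -(x - 1) ^ (j + 1) * h2

variable [CompleteSpace L]

/-- `log x = lim (x ^ (p ^ k) - 1) / p ^ k`. -/
lemma tendsto_logSeries (hp : ‖(p : L)‖ = (p : ℝ)⁻¹ ^ 2) {x : L} (hx : ‖x - 1‖ < 1) :
    Tendsto (fun k : ℕ => (x ^ (p ^ k) - 1) / (p : L) ^ k) atTop (𝓝 (logSeries x)) := by
  have h : ∀ k : ℕ, (x ^ (p ^ k) - 1) / (p : L) ^ k =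
      ∑' j : ℕ, ((p ^ k - 1).choose j : L) * ((x - 1) ^ (j + 1) / ((j + 1 : ℕ) : L)) := fun k => by
    rw [← pow_sub_one_div_eq_tsum x (pow_ne_zero k (Nat.Prime.ne_zero Fact.out)), Nat.cast_pow]
  simp_rw [h, logSeries]
  -- The binomial coefficients are integers, of norm at most 1, so the bound is uniform in k.
  refine tendsto_tsum_of_dominated (tendsto_norm_bound hx) (fun k j => ?_) fun j => ?_
  · rw [norm_mul]
    exact (mul_le_of_le_one_left (norm_nonneg _)
      (IsUltrametricDist.norm_natCast_le_one L _)).trans (norm_pow_div_le hp _ j)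
  · rw [mul_div_assoc]
    exact (tendsto_choose_prime_pow_sub_one hp j).mul_const _

lemma tendsto_pow_prime_pow (hp : ‖(p : L)‖ = (p : ℝ)⁻¹ ^ 2) {x : L} (hx : ‖x - 1‖ < 1) :
    Tendsto (fun k : ℕ => x ^ (p ^ k)) atTop (𝓝 1) := by
  have h := ((tendsto_logSeries hp hx).mul (tendsto_prime_pow hp)).add_const 1
  have hp0 : (p : L) ≠ 0 := Nat.cast_ne_zero.2 (Nat.Prime.ne_zero Fact.out)
  simpa [hp0] using h

omit [CharZero L] [CompleteSpace L] in
lemma norm_mul_sub_one_lt {x y : L} (hx : ‖x - 1‖ < 1) (hy : ‖y - 1‖ < 1) :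
    ‖x * y - 1‖ < 1 := by
  have : x * y - 1 = (x - 1) * (y - 1) + ((x - 1) + (y - 1)) := by ring
  rw [this]
  refine (IsUltrametricDist.norm_add_le_max _ _).trans_lt (max_lt ?_
    ((IsUltrametricDist.norm_add_le_max _ _).trans_lt (max_lt hx hy)))
  rw [norm_mul]
  exact mul_lt_one_of_nonneg_of_lt_one_left (norm_nonneg _) hx hy.le

omit [CharZero L] [CompleteSpace L] in
lemma norm_eq_one_of_norm_sub_one_lt {x : L} (hx : ‖x - 1‖ < 1) : ‖x‖ = 1 := by
  have h := IsUltrametricDist.norm_add_eq_max_of_norm_ne_norm (x := x - 1) (y := (1 : L))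
    (by rw [norm_one]; exact hx.ne)
  rwa [sub_add_cancel, norm_one, max_eq_right hx.le] at h

omit [CharZero L] [CompleteSpace L] in
lemma norm_inv_sub_one_lt {x : L} (hx : ‖x - 1‖ < 1) : ‖x⁻¹ - 1‖ < 1 := by
  have h1 := norm_eq_one_of_norm_sub_one_lt hx
  have h0 : x ≠ 0 := norm_ne_zero_iff.1 (h1 ▸ one_ne_zero)
  have : x⁻¹ - 1 = -(x⁻¹ * (x - 1)) := by field_simp; ring
  rwa [this, norm_neg, norm_mul, norm_inv, h1, inv_one, one_mul]

omit [CharZero L] [CompleteSpace L] in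
lemma norm_pow_sub_one_lt {x : L} (hx : ‖x - 1‖ < 1) (n : ℕ) : ‖x ^ n - 1‖ < 1 := by
  induction n with
  | zero => simp
  | succ n ih => rw [pow_succ]; exact norm_mul_sub_one_lt ih hx

omit [CharZero L] [CompleteSpace L] in
lemma norm_zpow_sub_one_lt {x : L} (hx : ‖x - 1‖ < 1) (n : ℤ) : ‖x ^ n - 1‖ < 1 := by
  obtain ⟨k, rfl | rfl⟩ := Int.eq_nat_or_neg n
  · simpa using norm_pow_sub_one_lt hx k
  · rw [zpow_neg, zpow_natCast]
    exact norm_inv_sub_one_lt (norm_pow_sub_one_lt hx k)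

/-- With q = p^k, (xy)^q - 1 = (x^q - 1)y^q + (y^q - 1). Divide by q and use y^q → 1. -/
lemma logSeries_mul (hp : ‖(p : L)‖ = (p : ℝ)⁻¹ ^ 2) {x y : L} (hx : ‖x - 1‖ < 1)
    (hy : ‖y - 1‖ < 1) : logSeries (x * y) = logSeries x + logSeries y := by
  refine tendsto_nhds_unique (tendsto_logSeries hp (norm_mul_sub_one_lt hx hy)) ?_
  have h := ((tendsto_logSeries hp hx).mul (tendsto_pow_prime_pow hp hy)).add
    (tendsto_logSeries hp hy)
  rw [mul_one] at h
  refine h.congr fun k => ?_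
  rw [mul_pow]
  ring

omit [IsUltrametricDist L] [CharZero L] [CompleteSpace L] in
lemma logSeries_one : logSeries (1 : L) = 0 := by
  simp [logSeries]

lemma logSeries_pow (hp : ‖(p : L)‖ = (p : ℝ)⁻¹ ^ 2) {x : L} (hx : ‖x - 1‖ < 1) (n : ℕ) :
    logSeries (x ^ n) = n * logSeries x := by
  induction n with
  | zero => simp [logSeries_one]
  | succ n ih =>
    rw [pow_succ, logSeries_mul hp (norm_pow_sub_one_lt hx n) hx, ih]
    push_cast
    ring

lemma logSeries_inv (hp : ‖(p : L)‖ = (p : ℝ)⁻¹ ^ 2) {x : L} (hx : ‖x - 1‖ < 1) :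
    logSeries x⁻¹ = -logSeries x := by
  have h := logSeries_mul hp hx (norm_inv_sub_one_lt hx)
  rw [mul_inv_cancel₀ (norm_ne_zero_iff.1 (norm_eq_one_of_norm_sub_one_lt hx ▸ one_ne_zero)),
    logSeries_one] at h
  exact (neg_eq_of_add_eq_zero_right h.symm).symm

lemma logSeries_zpow (hp : ‖(p : L)‖ = (p : ℝ)⁻¹ ^ 2) {x : L} (hx : ‖x - 1‖ < 1) (n : ℤ) :
    logSeries (x ^ n) = n * logSeries x := by
  obtain ⟨k, rfl | rfl⟩ := Int.eq_nat_or_neg n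
  · simpa using logSeries_pow hp hx k
  · rw [zpow_neg, zpow_natCast, logSeries_inv hp (norm_pow_sub_one_lt hx k), logSeries_pow hp hx]
    simp

/-- The logarithm agrees with `w` up to the quadratic term on a small disc. -/
lemma norm_logSeries_sub_le (hp : ‖(p : L)‖ = (p : ℝ)⁻¹ ^ 2) {ρ : ℝ} (hρ1 : ρ < 1)
    (hρ : ∀ j : ℕ, ρ ^ j * ‖(2 : L)‖ ≤ ‖((j + 2 : ℕ) : L)‖) {w : L} (hw : ‖w‖ ≤ ρ) :
    ‖logSeries (1 + w) - w‖ ≤ ‖w‖ ^ 2 / ‖(2 : L)‖ := by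
  have hw1 : ‖w‖ < 1 := hw.trans_lt hρ1
  have hsum : Summable fun n : ℕ => (-1) ^ n * (1 + w - 1) ^ (n + 1) / ((n + 1 : ℕ) : L) := by
    refine NonarchimedeanAddGroup.summable_of_tendsto_cofinite_zero ?_
    rw [Nat.cofinite_eq_atTop]
    refine squeeze_zero_norm (fun j => ?_) (tendsto_norm_bound hw1)
    have := norm_pow_div_le hp w j
    simpa [mul_div_assoc] using this
  have h2 : (0 : ℝ) < ‖(2 : L)‖ := norm_pos_iff.2 two_ne_zero
  rw [logSeries, hsum.tsum_eq_zero_add]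
  simp only [pow_zero, zero_add, pow_one, one_mul, Nat.cast_one, div_one, add_sub_cancel_left]
  refine IsUltrametricDist.norm_tsum_le_of_forall_le_of_nonneg (by positivity) fun j => ?_
  have h3 : (0 : ℝ) < ‖((j + 1 + 1 : ℕ) : L)‖ :=
    norm_pos_iff.2 (Nat.cast_ne_zero.2 (Nat.succ_ne_zero _))
  rw [norm_div, norm_mul, norm_pow, norm_neg, norm_one, one_pow, one_mul, norm_pow,
    div_le_div_iff₀ h3 h2]
  -- The term w^(j+2)/(j+2) is w² times w^j/(j+2), and the second factor is at most 1/‖2‖ by `hρ`.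
  have h4 : ‖w‖ ^ j * ‖(2 : L)‖ ≤ ‖((j + 1 + 1 : ℕ) : L)‖ :=
    le_trans (by gcongr) (hρ j)
  calc ‖w‖ ^ (j + 1 + 1) * ‖(2 : L)‖ = ‖w‖ ^ 2 * (‖w‖ ^ j * ‖(2 : L)‖) := by ring
    _ ≤ _ := by gcongr

end Logarithm

/-! ### The disc on which the logarithm is an isometry -/

section LogDisc

variable {p : ℕ} [Fact p.Prime] {L : Type*} [NormedField L]

/-- A radius below which the logarithm is dominated by its linear term. -/
structure IsLogRadius (p : ℕ) (L : Type*) [NormedField L] (ρ : ℝ) : Prop where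
  pos : 0 < ρ
  le : ρ ≤ (p : ℝ)⁻¹ * ‖(2 : L)‖
  norm_natCast : ∀ j : ℕ, ρ ^ j * ‖(2 : L)‖ ≤ ‖((j + 2 : ℕ) : L)‖

variable [IsUltrametricDist L]

lemma IsLogRadius.lt_one {ρ : ℝ} (h : IsLogRadius p L ρ) : ρ < 1 := by
  have h2 : ‖(2 : L)‖ ≤ 1 := by exact_mod_cast IsUltrametricDist.norm_natCast_le_one L 2
  have := h.le
  have := inv_prime_pos (p := p)
  have := inv_prime_lt_one (p := p)
  nlinarith

/-- The radius conditions in exponents of p⁻¹: if p^a exactly divides j + 2, then j + 2 has exponent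
2a in L. The exponent e of 2 is 2 for p = 2 and 0 otherwise. -/
lemma isLogRadius_pow (hp : ‖(p : L)‖ = (p : ℝ)⁻¹ ^ 2) {k e : ℕ}
    (h2 : ‖(2 : L)‖ = (p : ℝ)⁻¹ ^ e) (he : e + 1 ≤ k)
    (h : ∀ a j : ℕ, p ^ a ≤ j + 2 → 2 * a ≤ k * j + e) : IsLogRadius p L ((p : ℝ)⁻¹ ^ k) where
  pos := pow_pos inv_prime_pos k
  le := by
    rw [h2, ← pow_succ']
    exact pow_le_pow_of_le_one inv_prime_pos.le inv_prime_lt_one.le he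
  norm_natCast j := by
    obtain ⟨a, m, hm, hj⟩ :=
      Nat.exists_eq_pow_mul_and_not_dvd (Nat.succ_ne_zero (j + 1)) p (Nat.Prime.ne_one Fact.out)
    have hm1 : 1 ≤ m := Nat.one_le_iff_ne_zero.2 fun h => hm (h ▸ dvd_zero p)
    have hle : p ^ a ≤ j + 2 := by
      have : j + 2 = p ^ a * m := hj
      rw [this]
      exact Nat.le_mul_of_pos_right _ hm1
    have hj' : ((j + 2 : ℕ) : L) = (p : L) ^ a * m := by exact_mod_cast congrArg (Nat.cast (R := L)) hj
    rw [hj', norm_mul, norm_pow, hp, norm_natCast_eq_one_of_not_dvd (norm_prime_lt_one hp) hm,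
      mul_one, h2, ← pow_mul, ← pow_mul, ← pow_add]
    exact pow_le_pow_of_le_one inv_prime_pos.le inv_prime_lt_one.le (h a j hle)

/-- From 5 on, the denominators grow slowly enough for the whole maximal ideal to qualify. -/
lemma isLogRadius_of_five_le (hp : ‖(p : L)‖ = (p : ℝ)⁻¹ ^ 2) (h5 : 5 ≤ p) :
    IsLogRadius p L (p : ℝ)⁻¹ := by
  have h2 : ¬ p ∣ 2 := fun h => by have := Nat.le_of_dvd two_pos h; lia
  have h := isLogRadius_pow (k := 1) (e := 0) hp
    (by simpa using norm_natCast_eq_one_of_not_dvd (norm_prime_lt_one hp) h2) le_rfl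
    (fun a j hj => by
      have h1 : 5 ^ a ≤ j + 2 := (Nat.pow_le_pow_left h5 a).trans hj
      rcases Nat.eq_zero_or_pos a with rfl | ha
      · lia
      have h3 : ∀ b : ℕ, 2 * (b + 1) + 2 ≤ 5 ^ (b + 1) := fun b => by
        induction b with
        | zero => norm_num
        | succ b ih => rw [pow_succ]; lia
      have := h3 (a - 1)
      rw [Nat.sub_add_cancel ha] at this
      lia)
  simpa using h

/-- Radius 3⁻¹ would fail at the cubic term: for ‖w‖ = 3⁻¹ one has ‖w³/3‖ = ‖w‖. -/
lemma isLogRadius_three (hp : ‖((3 : ℕ) : L)‖ = ((3 : ℕ) : ℝ)⁻¹ ^ 2) :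
    IsLogRadius 3 L (((3 : ℕ) : ℝ)⁻¹ ^ 2) := by
  have : Fact (Nat.Prime 3) := ⟨Nat.prime_three⟩
  refine isLogRadius_pow (k := 2) (e := 0) hp
    (by simpa using norm_natCast_eq_one_of_not_dvd (n := 2) (norm_prime_lt_one hp) (by norm_num))
    one_le_two fun a j hj => ?_
  rcases Nat.eq_zero_or_pos a with rfl | ha
  · lia
  have h3 : ∀ b : ℕ, b + 1 + 2 ≤ 3 ^ (b + 1) := fun b => by
    induction b with
    | zero => norm_num
    | succ b ih => rw [pow_succ]; lia
  have := h3 (a - 1)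
  rw [Nat.sub_add_cancel ha] at this
  lia

/-- Exponent 3 is least possible: ‖w²/2‖ < ‖w‖ requires ‖w‖ < ‖2‖ = 2⁻². -/
lemma isLogRadius_two (hp : ‖((2 : ℕ) : L)‖ = ((2 : ℕ) : ℝ)⁻¹ ^ 2) :
    IsLogRadius 2 L (((2 : ℕ) : ℝ)⁻¹ ^ 3) := by
  have : Fact (Nat.Prime 2) := ⟨Nat.prime_two⟩
  refine isLogRadius_pow (k := 3) (e := 2) hp (by exact_mod_cast hp) le_rfl fun a j hj => ?_
  have : a + 1 ≤ 2 ^ a := Nat.lt_two_pow_self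
  lia

variable [CharZero L] [CompleteSpace L] {ρ : ℝ}

/-- The condition ρ ≤ p⁻¹‖2‖ turns the quadratic error w²/2 into a contraction by p⁻¹, which gives
both the isometry and surjectivity by iteration. -/
lemma norm_logSeries_sub_le_mul (hp : ‖(p : L)‖ = (p : ℝ)⁻¹ ^ 2) (hρ : IsLogRadius p L ρ) {w : L}
    (hw : ‖w‖ ≤ ρ) : ‖logSeries (1 + w) - w‖ ≤ (p : ℝ)⁻¹ * ‖w‖ := by
  refine (norm_logSeries_sub_le hp hρ.lt_one hρ.norm_natCast hw).trans ?_
  rw [div_le_iff₀ (norm_pos_iff.2 two_ne_zero)]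
  have := hw.trans hρ.le
  nlinarith [norm_nonneg w]

lemma norm_logSeries (hp : ‖(p : L)‖ = (p : ℝ)⁻¹ ^ 2) (hρ : IsLogRadius p L ρ) {w : L}
    (hw : ‖w‖ ≤ ρ) : ‖logSeries (1 + w)‖ = ‖w‖ := by
  rcases eq_or_ne w 0 with rfl | h0
  · simp [logSeries_one]
  have h := norm_logSeries_sub_le_mul hp hρ hw
  have h1 : ‖logSeries (1 + w) - w‖ < ‖w‖ :=
    h.trans_lt (mul_lt_of_lt_one_left (norm_pos_iff.2 h0) inv_prime_lt_one)
  have h2 := IsUltrametricDist.norm_add_eq_max_of_norm_ne_norm h1.ne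
  rwa [sub_add_cancel, max_eq_right h1.le] at h2

/-- Write y = x(1 + (y - x)/x) with ‖x‖ = 1: additivity moves the isometry at 1 to every principal
unit, whence continuity. -/
lemma norm_logSeries_sub (hp : ‖(p : L)‖ = (p : ℝ)⁻¹ ^ 2) (hρ : IsLogRadius p L ρ) {x y : L}
    (hx : ‖x - 1‖ < 1) (hy : ‖y - x‖ ≤ ρ) : ‖logSeries y - logSeries x‖ = ‖y - x‖ := by
  have h1 := norm_eq_one_of_norm_sub_one_lt hx
  have h0 : x ≠ 0 := norm_ne_zero_iff.1 (h1 ▸ one_ne_zero)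
  have hw : ‖(y - x) / x‖ = ‖y - x‖ := by rw [norm_div, h1, div_one]
  have hyx : y = x * (1 + (y - x) / x) := by field_simp; ring
  have h3 : logSeries y = logSeries x + logSeries (1 + (y - x) / x) := by
    conv_lhs => rw [hyx]
    refine logSeries_mul hp hx ?_
    rw [add_sub_cancel_left, hw]
    exact hy.trans_lt hρ.lt_one
  rw [h3, add_sub_cancel_left, norm_logSeries hp hρ (hw.trans_le hy), hw]

lemma tendsto_logSeries_of_tendsto (hp : ‖(p : L)‖ = (p : ℝ)⁻¹ ^ 2) (hρ : IsLogRadius p L ρ)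
    {α : Type*} {l : Filter α} {u : α → L} {x : L} (hx : ‖x - 1‖ < 1) (hu : Tendsto u l (𝓝 x)) :
    Tendsto (fun a => logSeries (u a)) l (𝓝 (logSeries x)) := by
  rw [tendsto_iff_norm_sub_tendsto_zero] at hu ⊢
  refine hu.congr' ?_
  filter_upwards [hu.eventually (ge_mem_nhds hρ.pos)] with a ha
  exact (norm_logSeries_sub hp hρ hx ha).symm

/-- The logarithm maps a small disc around `1` onto the disc of the same radius around `0`. -/
lemma exists_logSeries_eq (hp : ‖(p : L)‖ = (p : ℝ)⁻¹ ^ 2) (hρ : IsLogRadius p L ρ) {z : L}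
    (hz : ‖z‖ ≤ ρ) : ∃ w : L, ‖w‖ ≤ ρ ∧ logSeries (1 + w) = z := by
  -- Successive approximation: 1 + F(w) = (1 + w)(1 + (z - log(1 + w))), so the remaining error is
  -- corrected multiplicatively to first order and shrinks by p⁻¹ at each step.
  let F : L → L := fun w => w + (1 + w) * (z - logSeries (1 + w))
  let w : ℕ → L := fun n => F^[n] 0
  have hw : ∀ n, w (n + 1) = w n + (1 + w n) * (z - logSeries (1 + w n)) := fun n =>
    Function.iterate_succ_apply' F n 0
  have key : ∀ n, ‖w n‖ ≤ ρ ∧ ‖z - logSeries (1 + w n)‖ ≤ ρ * (p : ℝ)⁻¹ ^ n := by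
    intro n
    induction n with
    | zero =>
      have h0 : w 0 = 0 := rfl
      simpa [h0, logSeries_one] using ⟨hρ.pos.le, hz⟩
    | succ n ih =>
      obtain ⟨h1, h2⟩ := ih
      have h3 : ‖z - logSeries (1 + w n)‖ ≤ ρ := h2.trans
        (mul_le_of_le_one_right hρ.pos.le (pow_le_one₀ inv_prime_pos.le inv_prime_lt_one.le))
      have h4 : ‖1 + w n - 1‖ < 1 := by
        rw [add_sub_cancel_left]; exact h1.trans_lt hρ.lt_one
      have h5 := norm_eq_one_of_norm_sub_one_lt h4
      refine ⟨?_, ?_⟩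
      · rw [hw]
        refine (IsUltrametricDist.norm_add_le_max _ _).trans (max_le h1 ?_)
        rwa [norm_mul, h5, one_mul]
      · have h6 : 1 + w (n + 1) = (1 + w n) * (1 + (z - logSeries (1 + w n))) := by rw [hw]; ring
        have h7 : logSeries (1 + w (n + 1)) = logSeries (1 + w n) +
            logSeries (1 + (z - logSeries (1 + w n))) := by
          rw [h6]
          refine logSeries_mul hp h4 ?_
          rw [add_sub_cancel_left]
          exact h3.trans_lt hρ.lt_one
        rw [h7, ← sub_sub, norm_sub_rev]
        refine (norm_logSeries_sub_le_mul hp hρ h3).trans ?_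
        rw [pow_succ]
        nlinarith [inv_prime_pos (p := p)]
  have hcauchy : CauchySeq w := by
    refine cauchySeq_of_le_geometric (p : ℝ)⁻¹ ρ inv_prime_lt_one fun n => ?_
    obtain ⟨h1, h2⟩ := key n
    have h4 : ‖1 + w n - 1‖ < 1 := by
      rw [add_sub_cancel_left]; exact h1.trans_lt hρ.lt_one
    rw [dist_comm, dist_eq_norm_sub, hw, add_sub_cancel_left, norm_mul,
      norm_eq_one_of_norm_sub_one_lt h4, one_mul]
    exact h2
  obtain ⟨v, hv⟩ := cauchySeq_tendsto_of_complete hcauchy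
  have hvρ : ‖v‖ ≤ ρ := le_of_tendsto hv.norm (Eventually.of_forall fun n => (key n).1)
  refine ⟨v, hvρ, ?_⟩
  have hlog := tendsto_logSeries_of_tendsto hp hρ (x := 1 + v)
    (by rw [add_sub_cancel_left]; exact hvρ.trans_lt hρ.lt_one) (hv.const_add 1)
  refine tendsto_nhds_unique hlog ?_
  have hz' : Tendsto (fun n => z - logSeries (1 + w n)) atTop (𝓝 0) := by
    refine squeeze_zero_norm (fun n => (key n).2) ?_
    simpa using (tendsto_pow_atTop_nhds_zero_of_lt_one inv_prime_pos.le
      (inv_prime_lt_one (p := p))).const_mul ρ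
  simpa using hz'.const_sub z

omit [CharZero L] [CompleteSpace L] in
lemma norm_pow_sub_one_le {x : L} (hx : ‖x - 1‖ < 1) (n : ℕ) : ‖x ^ n - 1‖ ≤ ‖x - 1‖ := by
  induction n with
  | zero => simp
  | succ n ih =>
    have h : x ^ (n + 1) - 1 = x * (x ^ n - 1) + (x - 1) := by ring
    rw [h]
    refine (IsUltrametricDist.norm_add_le_max _ _).trans (max_le ?_ le_rfl)
    rwa [norm_mul, norm_eq_one_of_norm_sub_one_lt hx, one_mul]

/-- The closure of the powers of a principal unit contains its powers with exponents in `ℤ_p`. -/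
lemma exists_mem_closure_logSeries_eq (hp : ‖(p : L)‖ = (p : ℝ)⁻¹ ^ 2) (hρ : IsLogRadius p L ρ)
    {x : L} (hx : ‖x - 1‖ < 1) (z : ℤ_[p]) :
    ∃ u ∈ closure (Set.range fun n : ℕ => x ^ n), logSeries u = padicEmbedding hp z * logSeries x := by
  have hx1 := norm_eq_one_of_norm_sub_one_lt hx
  -- Truncations of z beyond level K differ by multiples of p^K, and x^(p^K) → 1.
  have hcauchy : CauchySeq fun k => x ^ z.appr k := by
    rw [Metric.cauchySeq_iff']
    intro ε hε
    obtain ⟨K, hK⟩ := ((Metric.tendsto_nhds.1 (tendsto_pow_prime_pow hp hx)) ε hε).exists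
    refine ⟨K, fun n hn => ?_⟩
    obtain ⟨d, hd⟩ := PadicInt.dvd_appr_sub_appr z K n hn
    have h1 : z.appr n = z.appr K + p ^ K * d := by
      have := PadicInt.appr_mono z hn
      lia
    rw [dist_eq_norm_sub] at hK ⊢
    have h2 : x ^ z.appr n - x ^ z.appr K = x ^ z.appr K * ((x ^ p ^ K) ^ d - 1) := by
      rw [h1, pow_add, pow_mul]; ring
    rw [h2, norm_mul, norm_pow, hx1, one_pow, one_mul]
    exact (norm_pow_sub_one_le (norm_pow_sub_one_lt hx _) d).trans_lt hK
  obtain ⟨u, hu⟩ := cauchySeq_tendsto_of_complete hcauchy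
  refine ⟨u, mem_closure_of_tendsto hu (Eventually.of_forall fun k => ⟨_, rfl⟩), ?_⟩
  have hu1 : ‖u - 1‖ < 1 := by
    have : u ∈ Metric.ball (1 : L) 1 := (IsUltrametricDist.isClosed_ball (1 : L) 1).mem_of_tendsto hu
      (Eventually.of_forall fun k => by
        rw [Metric.mem_ball, dist_eq_norm_sub]; exact norm_pow_sub_one_lt hx _)
    rwa [Metric.mem_ball, dist_eq_norm_sub] at this
  refine tendsto_nhds_unique (tendsto_logSeries_of_tendsto hp hρ hu1 hu) ?_
  simp_rw [logSeries_pow hp hx]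
  refine Tendsto.mul_const _ ?_
  have happr : Tendsto (fun k => ((z.appr k : ℕ) : ℚ_[p])) atTop (𝓝 (z : ℚ_[p])) := by
    rw [tendsto_iff_norm_sub_tendsto_zero]
    refine squeeze_zero (fun k => norm_nonneg _) (fun k => ?_)
      (tendsto_pow_atTop_nhds_zero_of_lt_one inv_prime_pos.le (inv_prime_lt_one (p := p)))
    have h := (PadicInt.norm_le_pow_iff_mem_span_pow _ k).2 (PadicInt.appr_spec k z)
    rw [norm_sub_rev, inv_pow, ← zpow_natCast, ← zpow_neg]
    simpa [PadicInt.norm_def] using h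
  have := ((continuous_padicEmbedding hp).tendsto _).comp happr
  refine this.congr fun k => ?_
  simp

/-- If all elements of `S` have logarithms in `ℤ_p log x` and `S` contains the powers of `x`, then
the logarithm maps the closure of `S` onto `ℤ_p log x`. -/
lemma logSeries_image_closure (hp : ‖(p : L)‖ = (p : ℝ)⁻¹ ^ 2) (hρ : IsLogRadius p L ρ)
    {x : L} {S : Set L} (hS : ∀ u ∈ S, ‖u - 1‖ < 1) (hxS : ∀ n : ℕ, x ^ n ∈ S)
    (hlog : ∀ u ∈ S, ∃ z : ℤ_[p], logSeries u = padicEmbedding hp z * logSeries x) :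
    logSeries '' closure S = Set.range fun z : ℤ_[p] => padicEmbedding hp z * logSeries x := by
  have hx : ‖x - 1‖ < 1 := by simpa using hS _ (hxS 1)
  ext y
  constructor
  · rintro ⟨u, hu, rfl⟩
    have hu1 : u ∈ Metric.ball (1 : L) 1 := closure_minimal (fun u hu => by
      rw [Metric.mem_ball, dist_eq_norm_sub]; exact hS u hu) (IsUltrametricDist.isClosed_ball 1 1) hu
    rw [Metric.mem_ball, dist_eq_norm_sub] at hu1
    obtain ⟨a, haS, ha⟩ := mem_closure_iff_seq_limit.1 hu
    -- The set ℤ_p log x is a continuous image of a compact space, so limits of logarithms stay in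
    -- it.
    have hcl : IsClosed (Set.range fun z : ℤ_[p] => padicEmbedding hp z * logSeries x) := by
      refine (isCompact_range ?_).isClosed
      exact ((continuous_padicEmbedding hp).comp continuous_subtype_val).mul_const _
    refine hcl.mem_of_tendsto (tendsto_logSeries_of_tendsto hp hρ hu1 ha)
      (Eventually.of_forall fun n => ?_)
    obtain ⟨z, hz⟩ := hlog _ (haS n)
    exact ⟨z, hz.symm⟩
  · rintro ⟨z, rfl⟩
    obtain ⟨u, hu, h⟩ := exists_mem_closure_logSeries_eq hp hρ hx z
    exact ⟨u, closure_mono (by rintro _ ⟨n, rfl⟩; exact hxS n) hu, h⟩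

/-- If `x ^ N - x ^ (-N)` is a rational multiple of `s` for every `N`, then `log x` is a
`p`-adic multiple of `s`. -/
lemma exists_logSeries_eq_mul (hp : ‖(p : L)‖ = (p : ℝ)⁻¹ ^ 2) {x s : L} (hx : ‖x - 1‖ < 1)
    (hs : s ≠ 0) (h : ∀ N : ℕ, ∃ b : ℚ, x ^ N - x⁻¹ ^ N = b * s) :
    ∃ c : ℚ_[p], logSeries x = padicEmbedding hp c * s := by
  choose b hb using h
  -- Averaging over x and x⁻¹ gives log x = lim (x^N - x^(-N))/(2N), N = p^k. Every approximant is
  -- rational times s, and ℚ_p is closed in L.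
  have h1 := (tendsto_logSeries hp hx).sub (tendsto_logSeries hp (norm_inv_sub_one_lt hx))
  rw [logSeries_inv hp hx] at h1
  have h2 : Tendsto (fun k => padicEmbedding hp ((b (p ^ k) / p ^ k / 2 : ℚ) : ℚ_[p])) atTop
      (𝓝 (logSeries x / s)) := by
    have := (h1.div_const 2).div_const s
    have h3 : (logSeries x - -logSeries x) / 2 / s = logSeries x / s := by ring
    rw [h3] at this
    refine this.congr fun k => ?_
    rw [map_ratCast, ← sub_div, sub_sub_sub_cancel_right, hb]
    push_cast
    field_simp
  obtain ⟨c, hc⟩ := (isClosed_range_padicEmbedding hp).mem_of_tendsto h2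
    (Eventually.of_forall fun k => ⟨_, rfl⟩)
  exact ⟨c, by rw [hc, div_mul_cancel₀ _ hs]⟩

omit [CharZero L] in
-- The left side is an even power of p, the right side zero or an odd power.
lemma norm_sq_ne_norm_sq_mul_inv {a b : ℚ_[p]} (h : a ≠ 0) :
    ‖a‖ ^ 2 ≠ ‖b‖ ^ 2 * (p : ℝ)⁻¹ := by
  intro hab
  have hb : b ≠ 0 := by
    rintro rfl
    simp [h] at hab
  have hp1 : (1 : ℝ) < p := Nat.one_lt_cast.2 (Nat.Prime.one_lt Fact.out)
  rw [Padic.norm_eq_zpow_neg_valuation h, Padic.norm_eq_zpow_neg_valuation hb, ← zpow_natCast,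
    ← zpow_natCast, ← zpow_mul, ← zpow_mul, ← zpow_neg_one, ← zpow_add₀ (by positivity)] at hab
  have := zpow_right_injective₀ (by positivity) hp1.ne' hab
  push_cast at this
  lia

/-- By this parity no cancellation can occur: 1 and a uniformizer are orthogonal over ℚ_p. -/
lemma norm_padicEmbedding_add_mul (hp : ‖(p : L)‖ = (p : ℝ)⁻¹ ^ 2) {π : L} (hπ : ‖π‖ = (p : ℝ)⁻¹)
    (a b : ℚ_[p]) :
    ‖padicEmbedding hp a + padicEmbedding hp b * π‖ = max (‖a‖ ^ 2) (‖b‖ ^ 2 * (p : ℝ)⁻¹) := by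
  have hb : ‖padicEmbedding hp b * π‖ = ‖b‖ ^ 2 * (p : ℝ)⁻¹ := by
    rw [norm_mul, norm_padicEmbedding, hπ]
  rcases eq_or_ne a 0 with rfl | ha
  · rw [map_zero, zero_add, hb, norm_zero, zero_pow two_ne_zero, max_eq_right]
    exact mul_nonneg (sq_nonneg _) inv_prime_pos.le
  rw [IsUltrametricDist.norm_add_eq_max_of_norm_ne_norm, hb, norm_padicEmbedding]
  rw [hb, norm_padicEmbedding]
  exact norm_sq_ne_norm_sq_mul_inv ha

end LogDisc

/-! ### The torsion of a quotient of lattices -/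

section Torsion

variable {p : ℕ} [Fact p.Prime] {A : Type*} [AddCommGroup A] [IsAddTorsionFree A]

/-- Let `g : ℚ_p → A` be injective and `M ≤ Λ` subgroups of `A` with `M = g (ℤ_p b)`, `b ≠ 0`, and
`Λ ∩ g ℚ_p = g ℤ_p`. Then the torsion of `Λ / M` has order `‖b‖⁻¹`. -/
theorem card_torsion_quotient (g : ℚ_[p] →+ A) (hg : Function.Injective g) (Λ M : AddSubgroup A)
    {b : ℚ_[p]} (hb : b ≠ 0) (hΛ : ∀ c, g c ∈ Λ ↔ ‖c‖ ≤ 1)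
    (hM : ∀ x, x ∈ M ↔ ∃ z : ℤ_[p], x = g (z * b)) (hMΛ : M ≤ Λ) :
    Finite (AddCommGroup.torsion (Λ ⧸ M.addSubgroupOf Λ)) ∧
    ∃ r : ℕ, Nat.card (AddCommGroup.torsion (Λ ⧸ M.addSubgroupOf Λ)) = p ^ r ∧
      ‖b‖ = (p : ℝ)⁻¹ ^ r := by
  have hb1 : ‖b‖ ≤ 1 := (hΛ b).1 (hMΛ ((hM _).2 ⟨1, by simp⟩))
  obtain ⟨b, rfl⟩ : ∃ b' : ℤ_[p], (b' : ℚ_[p]) = b := ⟨⟨b, hb1⟩, rfl⟩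
  have hb0 : b ≠ 0 := fun h => hb (by simp [h])
  let j : ℤ_[p] →+ Λ :=
    (g.comp (PadicInt.Coe.ringHom (p := p)).toAddMonoidHom).codRestrict Λ fun z =>
      (hΛ _).2 z.norm_le_one
  have hj : ∀ z : ℤ_[p], ((j z : Λ) : A) = g (z : ℚ_[p]) := fun z => rfl
  let φ : ℤ_[p] →+ Λ ⧸ M.addSubgroupOf Λ := (QuotientAddGroup.mk' _).comp j
  -- The kernel of ℤ_p → Λ/M is bℤ_p, and b is a unit times a power of p; so it is the kernel of
  -- reduction modulo that power.
  have hker : φ.ker = (RingHom.ker (PadicInt.toZModPow (p := p) b.valuation)).toAddSubgroup := by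
    ext z
    have h1 : z ∈ φ.ker ↔ b ∣ z := by
      rw [AddMonoidHom.mem_ker, AddMonoidHom.comp_apply, QuotientAddGroup.mk'_apply,
        QuotientAddGroup.eq_zero_iff, AddSubgroup.mem_addSubgroupOf, hj, hM]
      constructor
      · rintro ⟨w, hw⟩
        refine ⟨w, ?_⟩
        have := hg hw
        rw [mul_comm]
        exact Subtype.ext this
      · rintro ⟨w, rfl⟩
        exact ⟨w, by push_cast; rw [mul_comm]⟩
    rw [h1, Submodule.mem_toAddSubgroup, PadicInt.ker_toZModPow, Ideal.mem_span_singleton]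
    conv_lhs => rw [PadicInt.unitCoeff_spec hb0]
    exact Units.mul_left_dvd
  -- If n x = g(zb), torsion-freeness of A gives x = g(zb/n); as x ∈ Λ, the coefficient zb/n is in
  -- ℤ_p.
  have hrange : φ.range = AddCommGroup.torsion (Λ ⧸ M.addSubgroupOf Λ) := by
    ext y
    obtain ⟨x, rfl⟩ := QuotientAddGroup.mk'_surjective _ y
    constructor
    · rintro ⟨z, hz⟩
      rw [← hz]
      refine isOfFinAddOrder_iff_nsmul_eq_zero.2
        ⟨p ^ b.valuation, pow_pos (Nat.Prime.pos Fact.out) _, ?_⟩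
      rw [← map_nsmul, ← AddMonoidHom.mem_ker, hker, Submodule.mem_toAddSubgroup,
        PadicInt.ker_toZModPow, Ideal.mem_span_singleton, nsmul_eq_mul, Nat.cast_pow]
      exact dvd_mul_right _ _
    · intro hx
      obtain ⟨n, hn, hnx⟩ := isOfFinAddOrder_iff_nsmul_eq_zero.1 hx
      rw [← map_nsmul, QuotientAddGroup.mk'_apply, QuotientAddGroup.eq_zero_iff,
        AddSubgroup.mem_addSubgroupOf, hM] at hnx
      obtain ⟨z, hz⟩ := hnx
      have hn' : (n : ℚ_[p]) ≠ 0 := Nat.cast_ne_zero.2 hn.ne'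
      have hx' : (x : A) = g (z * b / n) := by
        refine nsmul_right_injective hn.ne' ?_
        change n • (x : A) = n • g (z * b / n)
        rw [← map_nsmul, nsmul_eq_mul, mul_div_cancel₀ _ hn']
        simpa using hz
      have hle : ‖(z * b / n : ℚ_[p])‖ ≤ 1 := (hΛ _).1 (hx' ▸ x.2)
      refine ⟨⟨_, hle⟩, ?_⟩
      have : j ⟨_, hle⟩ = x := Subtype.ext ((hj ⟨_, hle⟩).trans hx'.symm)
      exact congrArg (QuotientAddGroup.mk' (M.addSubgroupOf Λ)) this
  have hindex : φ.ker.index = p ^ b.valuation := by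
    rw [hker]
    have h := AddSubgroup.index_ker (PadicInt.toZModPow (p := p) b.valuation).toAddMonoidHom
    rw [AddMonoidHom.range_eq_top.2 (ZMod.ringHom_surjective _), AddSubgroup.card_top,
      Nat.card_zmod] at h
    exact h
  rw [AddSubgroup.index_ker, hrange] at hindex
  refine ⟨Nat.finite_of_card_ne_zero ?_, b.valuation, hindex, ?_⟩
  · rw [hindex]
    exact pow_ne_zero _ (Nat.Prime.ne_zero Fact.out)
  · have := PadicInt.norm_eq_zpow_neg_valuation hb0
    rw [PadicInt.norm_def] at this
    rw [this, inv_pow, zpow_neg, zpow_natCast]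

end Torsion

/-! ### Generators of the principal units and their logarithms -/

section PrincipalUnits

/-- The properties of a totally ramified quadratic extension `L` of `ℚ_p`, normed so that a
uniformizer has norm `p⁻¹`, that determine the logarithms of its principal units. -/
structure IsRamifiedQuadratic (p : ℕ) (L : Type*) [NormedField L] : Prop where
  norm_prime : ‖(p : L)‖ = (p : ℝ)⁻¹ ^ 2
  norm_le : ∀ x : L, ‖x‖ < 1 → ‖x‖ ≤ (p : ℝ)⁻¹
  residue : ∀ x : L, ‖x‖ ≤ 1 → ∃ n : ℕ, n < p ∧ ‖x - n‖ < 1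

/-- The group of principal units of a normed field. -/
def unitDisc (L : Type*) [NormedField L] : Set L := {u | ‖u - 1‖ < 1}

variable {p : ℕ} [Fact p.Prime] {L : Type*} [NormedField L] [IsUltrametricDist L]

lemma norm_sub_le_of_le {x y : L} {r : ℝ} (hx : ‖x‖ ≤ r) (hy : ‖y‖ ≤ r) : ‖x - y‖ ≤ r := by
  rw [sub_eq_add_neg]
  exact (IsUltrametricDist.norm_add_le_max _ _).trans (max_le hx (by rwa [norm_neg]))

lemma norm_add_le_of_le {x y : L} {r : ℝ} (hx : ‖x‖ ≤ r) (hy : ‖y‖ ≤ r) : ‖x + y‖ ≤ r :=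
  (IsUltrametricDist.norm_add_le_max _ _).trans (max_le hx hy)

lemma norm_intCast_mul_le {x : L} {r : ℝ} (n : ℤ) (hx : ‖x‖ ≤ r) : ‖(n : L) * x‖ ≤ r := by
  rw [norm_mul]
  exact (mul_le_of_le_one_left (norm_nonneg _) (IsUltrametricDist.norm_intCast_le_one L n)).trans hx

/-- Discreteness: the first value of ‖c‖ above 1 is p, and p² > p. -/
lemma norm_sq_mul_inv_le_one_iff (c : ℚ_[p]) : ‖c‖ ^ 2 * (p : ℝ)⁻¹ ≤ 1 ↔ ‖c‖ ≤ 1 := by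
  have hp1 : (1 : ℝ) < p := Nat.one_lt_cast.2 (Nat.Prime.one_lt Fact.out)
  rw [← div_eq_mul_inv, div_le_one (by positivity)]
  constructor
  · intro h
    have h1 := (Padic.norm_le_pow_iff_norm_lt_pow_add_one c 0).2
    rw [zpow_zero, zero_add, zpow_one] at h1
    refine h1 ?_
    by_contra! h2
    nlinarith
  · intro h
    nlinarith [norm_nonneg c]

lemma exists_int_norm_sub_le {c : ℚ_[p]} (hc : ‖c‖ ≤ 1) : ∃ n : ℤ, ‖c - n‖ ≤ (p : ℝ)⁻¹ := by
  obtain ⟨c, rfl⟩ : ∃ z : ℤ_[p], (z : ℚ_[p]) = c := ⟨⟨c, hc⟩, rfl⟩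
  obtain ⟨n, -, hn⟩ := PadicInt.exists_mem_range (p := p) c
  refine ⟨n, ?_⟩
  have := (PadicInt.mem_nonunits.1 ((IsLocalRing.mem_maximalIdeal _).1 hn))
  rw [PadicInt.norm_def, PadicInt.coe_sub, PadicInt.coe_natCast] at this
  have h2 := (Padic.norm_lt_pow_iff_norm_le_pow_sub_one ((c : ℚ_[p]) - (n : ℚ_[p])) 0).1 (by rwa [zpow_zero])
  simpa using h2

variable [CharZero L] [CompleteSpace L] {ρ : ℝ}

/-- Compare (-x)² = x² and divide by 2. The two hypotheses together force ‖2‖ < 1, so this concerns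
p = 2. -/
lemma logSeries_neg (hp : ‖(p : L)‖ = (p : ℝ)⁻¹ ^ 2) {x : L} (hx : ‖x - 1‖ < 1)
    (hx' : ‖-x - 1‖ < 1) : logSeries (-x) = logSeries x := by
  have h := logSeries_mul hp hx' hx'
  rw [neg_mul_neg, logSeries_mul hp hx hx, ← two_mul, ← two_mul] at h
  exact (mul_left_cancel₀ two_ne_zero h).symm

lemma mem_logSeries_image_iff_norm_le (hp : ‖(p : L)‖ = (p : ℝ)⁻¹ ^ 2) (hρ : IsLogRadius p L ρ)
    (h : ∀ x : L, ‖x‖ < 1 → ‖x‖ ≤ ρ) (y : L) : y ∈ logSeries '' unitDisc L ↔ ‖y‖ ≤ ρ := by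
  constructor
  · rintro ⟨u, hu, rfl⟩
    have h1 := h _ hu
    rwa [← norm_logSeries hp hρ h1, add_sub_cancel] at h1
  · intro hy
    obtain ⟨w, hw, rfl⟩ := exists_logSeries_eq hp hρ hy
    refine ⟨1 + w, ?_, rfl⟩
    change ‖1 + w - 1‖ < 1
    rw [add_sub_cancel_left]
    exact hw.trans_lt hρ.lt_one

/-- If `g`, `-1` and a small disc generate the principal units, then `log g` and the disc
generate their logarithms; it suffices to know `log g` up to an element of the disc. -/
lemma mem_logSeries_image_iff (hp : ‖(p : L)‖ = (p : ℝ)⁻¹ ^ 2) (hρ : IsLogRadius p L ρ)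
    {g ℓ : L} (hg : ‖g - 1‖ < 1) (hℓ : ‖logSeries g - ℓ‖ ≤ ρ)
    (hgen : ∀ u : L, ‖u - 1‖ < 1 → ∃ n : ℕ, ∃ w : L, ‖w‖ ≤ ρ ∧
      (u = g ^ n * (1 + w) ∨ u = -(g ^ n * (1 + w)))) (y : L) :
    y ∈ logSeries '' unitDisc L ↔ ∃ n : ℤ, ‖y - n * ℓ‖ ≤ ρ := by
  have hiff : ∀ n : ℤ, ‖y - n * ℓ‖ ≤ ρ ↔ ‖y - n * logSeries g‖ ≤ ρ := by
    intro n
    have h1 : ‖(n : L) * (logSeries g - ℓ)‖ ≤ ρ := norm_intCast_mul_le n hℓ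
    constructor
    · intro h
      have := norm_sub_le_of_le h h1
      convert this using 2
      ring
    · intro h
      have := norm_add_le_of_le h h1
      convert this using 2
      ring
  simp_rw [hiff]
  constructor
  · rintro ⟨u, hu, rfl⟩
    obtain ⟨n, w, hw, hu'⟩ := hgen u hu
    refine ⟨n, ?_⟩
    have hw1 : ‖1 + w - 1‖ < 1 := by rw [add_sub_cancel_left]; exact hw.trans_lt hρ.lt_one
    have hgn := norm_pow_sub_one_lt hg n
    have h1 : logSeries u = logSeries (g ^ n * (1 + w)) := by
      rcases hu' with h | h
      · rw [h]
      · rw [h]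
        exact logSeries_neg hp (norm_mul_sub_one_lt hgn hw1) (h ▸ hu)
    rw [h1, logSeries_mul hp hgn hw1, logSeries_pow hp hg, Int.cast_natCast, add_sub_cancel_left,
      norm_logSeries hp hρ hw]
    exact hw
  · rintro ⟨n, hn⟩
    obtain ⟨w, hw, hwy⟩ := exists_logSeries_eq hp hρ hn
    have hw1 : ‖1 + w - 1‖ < 1 := by rw [add_sub_cancel_left]; exact hw.trans_lt hρ.lt_one
    have hgn := norm_zpow_sub_one_lt hg n
    refine ⟨g ^ n * (1 + w), norm_mul_sub_one_lt hgn hw1, ?_⟩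
    rw [logSeries_mul hp hgn hw1, hwy, logSeries_zpow hp hg]
    ring

/-- The norm of the logarithm of `g`, computed up to an error, from a power of `g`. -/
lemma norm_logSeries_sub_le_of_pow (hp : ‖(p : L)‖ = (p : ℝ)⁻¹ ^ 2) (hρ : IsLogRadius p L ρ)
    {g : L} (hg : ‖g - 1‖ < 1) {n : ℕ} (hn : n ≠ 0) {r : ℝ} (hr : ‖g ^ n - 1‖ ≤ r) (hrρ : r ≤ ρ)
    (h : r ^ 2 ≤ ρ * (‖(2 : L)‖ * ‖(n : L)‖)) : ‖logSeries g - (g ^ n - 1) / n‖ ≤ ρ := by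
  have h2 : 0 < ‖(2 : L)‖ := norm_pos_iff.2 two_ne_zero
  have hn' : (n : L) ≠ 0 := Nat.cast_ne_zero.2 hn
  have hn0 : 0 < ‖(n : L)‖ := norm_pos_iff.2 hn'
  -- As gⁿ is in the disc, n log g = log gⁿ agrees with gⁿ - 1 up to r²/‖2‖; dividing by n leaves
  -- the error bounded in `h`.
  have h1 := norm_logSeries_sub_le hp hρ.lt_one hρ.norm_natCast (hr.trans hrρ)
  rw [add_sub_cancel, logSeries_pow hp hg] at h1
  have h3 : logSeries g - (g ^ n - 1) / n = (n * logSeries g - (g ^ n - 1)) / n := by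
    field_simp
  rw [h3, norm_div, div_le_iff₀ hn0]
  refine h1.trans ?_
  rw [div_le_iff₀ h2]
  calc ‖g ^ n - 1‖ ^ 2 ≤ r ^ 2 := by gcongr
    _ ≤ _ := h.trans_eq (by ring)

omit [CharZero L] [CompleteSpace L] in
lemma norm_one_add_pow_sub_le {t : L} (ht : ‖t‖ < 1) (n : ℕ) :
    ‖(1 + t) ^ n - (1 + n * t)‖ ≤ ‖t‖ ^ 2 := by
  induction n with
  | zero => simp
  | succ n ih =>
    have h : (1 + t) ^ (n + 1) - (1 + (n + 1 : ℕ) * t) =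
        (1 + t) * ((1 + t) ^ n - (1 + n * t)) + (n : ℤ) * t ^ 2 := by push_cast; ring
    rw [h]
    refine norm_add_le_of_le ?_ (norm_intCast_mul_le _ (norm_pow t 2).le)
    rwa [norm_mul, norm_eq_one_of_norm_sub_one_lt (by rwa [add_sub_cancel_left]), one_mul]

omit [CharZero L] [CompleteSpace L] in
/-- A principal unit is, modulo the square of the maximal ideal, a power of a given principal unit
`1 + t` with `t` a uniformizer. -/
lemma exists_eq_pow_mul (hL : IsRamifiedQuadratic p L) {t : L} (ht : ‖t‖ = (p : ℝ)⁻¹) {u : L}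
    (hu : ‖u - 1‖ < 1) : ∃ n : ℕ, ∃ w : L, ‖w‖ ≤ (p : ℝ)⁻¹ ^ 2 ∧ u = (1 + t) ^ n * (1 + w) := by
  have hq := inv_prime_pos (p := p)
  have ht1 : ‖t‖ < 1 := ht ▸ inv_prime_lt_one
  have ht0 : t ≠ 0 := norm_ne_zero_iff.1 (ht ▸ hq.ne')
  -- The residue of (u - 1)/t is the exponent: it matches u and (1 + t)ⁿ to first order in t.
  obtain ⟨n, -, hn⟩ := hL.residue ((u - 1) / t) (by
    rw [norm_div, ht, div_le_one hq]; exact hL.norm_le _ hu)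
  have h1 : ‖u - 1 - n * t‖ ≤ (p : ℝ)⁻¹ ^ 2 := by
    have h2 : u - 1 - n * t = ((u - 1) / t - n) * t := by field_simp
    have := hL.norm_le _ hn
    rw [h2, norm_mul, ht, sq]
    gcongr
  have h3 : ‖(1 + t) ^ n‖ = 1 := by
    rw [norm_pow, norm_eq_one_of_norm_sub_one_lt (by rwa [add_sub_cancel_left]), one_pow]
  have h4 : (1 + t) ^ n ≠ 0 := norm_ne_zero_iff.1 (h3 ▸ one_ne_zero)
  refine ⟨n, (u - (1 + t) ^ n) / (1 + t) ^ n, ?_, by field_simp; ring⟩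
  rw [norm_div, h3, div_one]
  have h6 : u - (1 + t) ^ n = u - 1 - n * t - ((1 + t) ^ n - (1 + n * t)) := by ring
  rw [h6]
  exact norm_sub_le_of_le h1 (ht ▸ norm_one_add_pow_sub_le ht1 n)

end PrincipalUnits

/-! ### The intersection of log U with the line ℚ_p √m -/

section Lattice

variable {L : Type*} [NormedField L] [IsUltrametricDist L] [CharZero L] [CompleteSpace L]

lemma logSeries_image_of_five_le {p : ℕ} [Fact p.Prime] (hL : IsRamifiedQuadratic p L) (h5 : 5 ≤ p)
    {s : L} (hs : ‖s‖ = (p : ℝ)⁻¹) (c : ℚ_[p]) :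
    padicEmbedding hL.norm_prime c * s ∈ logSeries '' unitDisc L ↔ ‖c‖ ≤ 1 := by
  rw [mem_logSeries_image_iff_norm_le hL.norm_prime (isLogRadius_of_five_le hL.norm_prime h5)
    hL.norm_le, norm_mul, norm_padicEmbedding, hs]
  have := inv_prime_pos (p := p)
  rw [← sq_le_one_iff₀ (norm_nonneg c)]
  exact ⟨fun h => le_of_mul_le_mul_right (by simpa using h) this,
    fun h => mul_le_of_le_one_left this.le h⟩

/-! ### The case p = 3 -/

section Three

variable (hL : IsRamifiedQuadratic 3 L) {m : ℤ} {s : L} (hs2 : s ^ 2 = m)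
  (hs : ‖s‖ = ((3 : ℕ) : ℝ)⁻¹)
include hL hs2 hs

/-- Since s³ = ms = 3as, (1 + s)³ - 1 = 3(s + as + s²) is small enough to read off log(1 + s) modulo
the disc, where s² is negligible. Only a mod 3 matters. -/
lemma norm_logSeries_one_add_sub_three {a : ℤ} (hm : m = 3 * a) :
    ‖logSeries (1 + s) - s * (1 + a)‖ ≤ ((3 : ℕ) : ℝ)⁻¹ ^ 2 := by
  have : Fact (Nat.Prime 3) := ⟨Nat.prime_three⟩
  have h3 := hL.norm_prime
  have h2 : ‖(2 : L)‖ = 1 := by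
    simpa using norm_natCast_eq_one_of_not_dvd (n := 2) (norm_prime_lt_one h3) (by norm_num)
  have hs' : ‖s‖ = 1 / 3 := by rw [hs]; norm_num
  have h3' : ‖(3 : L)‖ = 1 / 9 := by have := h3; norm_num at this; rw [this]
  have hm' : (m : L) = 3 * a := by rw [hm]; push_cast; ring
  have ha := IsUltrametricDist.norm_intCast_le_one L a
  have hw : (1 + s) ^ 3 - 1 = 3 * (s + s * a + s ^ 2) := by
    linear_combination s * hs2 + s * hm'
  have h4 : ‖s + s * a + s ^ 2‖ ≤ 1 / 3 := by
    refine norm_add_le_of_le (norm_add_le_of_le hs'.le ?_) ?_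
    · rw [mul_comm]; exact norm_intCast_mul_le a hs'.le
    · rw [norm_pow, hs']; norm_num
  have h5 := norm_logSeries_sub_le_of_pow h3 (isLogRadius_three h3) (g := 1 + s)
    (by rw [add_sub_cancel_left, hs']; norm_num) (n := 3) (by norm_num) (r := 1 / 27)
    (by rw [hw, norm_mul, h3']; linarith) (by norm_num) (by rw [h2, h3]; norm_num)
  rw [hw] at h5
  have h6 : (3 * (s + s * a + s ^ 2)) / ((3 : ℕ) : L) = s * (1 + a) + s ^ 2 := by
    push_cast
    field_simp
  rw [h6] at h5
  have h7 : logSeries (1 + s) - s * (1 + a) =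
      (logSeries (1 + s) - (s * (1 + a) + s ^ 2)) + s ^ 2 := by ring
  rw [h7]
  refine norm_add_le_of_le h5 ?_
  rw [norm_pow, hs]

omit hs2 in
lemma mem_logSeries_image_iff_three {ℓ : L}
    (hℓ : ‖logSeries (1 + s) - ℓ‖ ≤ ((3 : ℕ) : ℝ)⁻¹ ^ 2) (y : L) :
    y ∈ logSeries '' unitDisc L ↔ ∃ n : ℤ, ‖y - n * ℓ‖ ≤ ((3 : ℕ) : ℝ)⁻¹ ^ 2 := by
  have : Fact (Nat.Prime 3) := ⟨Nat.prime_three⟩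
  refine mem_logSeries_image_iff hL.norm_prime (isLogRadius_three hL.norm_prime) (g := 1 + s)
    ?_ hℓ (fun u hu => ?_) y
  · rw [add_sub_cancel_left, hs]
    norm_num
  · obtain ⟨n, w, hw, hu'⟩ := exists_eq_pow_mul hL hs hu
    exact ⟨n, w, hw, Or.inl hu'⟩

/-- Here 1 + a ≡ -1 mod 3, so log(1 + s) ≡ -s. Thus log U is ℤs plus the disc, and the disc meets
the line in 3ℤ_3 s. -/
lemma logSeries_image_three_of_mod_nine_eq_three [Fact (Nat.Prime 3)] (hm : m % 9 = 3)
    (c : ℚ_[3]) : padicEmbedding hL.norm_prime c * s ∈ logSeries '' unitDisc L ↔ ‖c‖ ≤ 1 := by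
  obtain ⟨k, rfl⟩ : ∃ k, m = 3 * (3 * k + 1) := ⟨m / 9, by lia⟩
  have hs' : ‖s‖ = 1 / 3 := by rw [hs]; norm_num
  have hℓ : ‖logSeries (1 + s) - -s‖ ≤ ((3 : ℕ) : ℝ)⁻¹ ^ 2 := by
    have h1 := norm_logSeries_one_add_sub_three hL hs2 hs rfl
    have h2 : ‖((k + 1 : ℤ) : L) * (((3 : ℕ) : L) * s)‖ ≤ ((3 : ℕ) : ℝ)⁻¹ ^ 2 := by
      refine norm_intCast_mul_le _ ?_
      rw [norm_mul, hL.norm_prime, hs]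
      norm_num
    convert norm_add_le_of_le h1 h2 using 2
    push_cast
    ring
  rw [mem_logSeries_image_iff_three hL hs hℓ]
  have key : ∀ n : ℤ, ‖padicEmbedding hL.norm_prime c * s - n * -s‖ = ‖c + n‖ ^ 2 * (1 / 3) := by
    intro n
    have : padicEmbedding hL.norm_prime c * s - n * -s =
        padicEmbedding hL.norm_prime (c + n) * s := by
      rw [map_add, map_intCast]; ring
    rw [this, norm_mul, norm_padicEmbedding, hs']
  simp_rw [key]
  constructor
  · rintro ⟨n, hn⟩
    have h1 : ‖c + n‖ ≤ 1 := by
      rw [← sq_le_one_iff₀ (norm_nonneg _)]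
      norm_num at hn
      linarith
    have := norm_sub_le_of_le h1 (IsUltrametricDist.norm_intCast_le_one ℚ_[3] n)
    rwa [add_sub_cancel_right] at this
  · intro hc
    obtain ⟨n, hn⟩ := exists_int_norm_sub_le hc
    refine ⟨-n, ?_⟩
    push_cast
    rw [← sub_eq_add_neg]
    norm_num at hn ⊢
    nlinarith [norm_nonneg (c - n)]

/-- Here 1 + a ≡ 0 mod 3, so log(1 + s) is absorbed: log U is the disc of radius 1/9, and ‖3cs‖ =
‖c‖²/27. -/
lemma logSeries_image_three_of_mod_nine_eq_six [Fact (Nat.Prime 3)] (hm : m % 9 = 6)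
    (c : ℚ_[3]) : padicEmbedding hL.norm_prime c * (3 * s) ∈ logSeries '' unitDisc L ↔ ‖c‖ ≤ 1 := by
  obtain ⟨k, rfl⟩ : ∃ k, m = 3 * (3 * k + 2) := ⟨m / 9, by lia⟩
  have hℓ : ‖logSeries (1 + s) - 0‖ ≤ ((3 : ℕ) : ℝ)⁻¹ ^ 2 := by
    have h1 := norm_logSeries_one_add_sub_three hL hs2 hs rfl
    have h2 : ‖((k + 1 : ℤ) : L) * (((3 : ℕ) : L) * s)‖ ≤ ((3 : ℕ) : ℝ)⁻¹ ^ 2 := by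
      refine norm_intCast_mul_le _ ?_
      rw [norm_mul, hL.norm_prime, hs]
      norm_num
    convert norm_add_le_of_le h1 h2 using 2
    push_cast
    ring
  have h3 : ‖(3 : L)‖ = ((3 : ℕ) : ℝ)⁻¹ ^ 2 := by exact_mod_cast hL.norm_prime
  rw [mem_logSeries_image_iff_three hL hs hℓ, ← norm_sq_mul_inv_le_one_iff c]
  simp only [mul_zero, sub_zero, exists_const, norm_mul, norm_padicEmbedding, hs, h3]
  norm_num
  constructor <;> intro h <;> linarith

end Three

/-! ### The case p = 2 -/

section Two

variable (hL : IsRamifiedQuadratic 2 L)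
include hL

lemma mem_logSeries_image_iff_two {g ℓ : L} (hg : ‖g - 1‖ = ((2 : ℕ) : ℝ)⁻¹)
    (hℓ : ‖logSeries g - ℓ‖ ≤ 1 / 8) (y : L) :
    y ∈ logSeries '' unitDisc L ↔ ∃ n : ℤ, ‖y - n * ℓ‖ ≤ 1 / 8 := by
  have : Fact (Nat.Prime 2) := ⟨Nat.prime_two⟩
  have hρ := isLogRadius_two hL.norm_prime
  have h8 : ((2 : ℕ) : ℝ)⁻¹ ^ 3 = 1 / 8 := by norm_num
  have h2 : ‖(2 : L)‖ = 1 / 4 := by have := hL.norm_prime; norm_num at this; rw [this]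
  rw [h8] at hρ
  refine mem_logSeries_image_iff hL.norm_prime hρ ?_ hℓ (fun u hu => ?_) y
  · rw [hg]
    norm_num
  · obtain ⟨n, w, hw, hu'⟩ := exists_eq_pow_mul hL hg hu
    rw [add_sub_cancel] at hu'
    -- The residue of w/2 decides: if it is 0, w is in the disc; if it is 1, then 1 + w ≡ 3 ≡ -1 and
    -- the sign absorbs it.
    obtain ⟨i, hi, hwi⟩ := hL.residue (w / 2) (by
      rw [norm_div, h2, div_le_one (by norm_num)]; refine hw.trans (by norm_num))
    have h3 : ‖w - 2 * i‖ ≤ 1 / 8 := by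
      have h4 := hL.norm_le _ hwi
      have h5 : w - 2 * i = 2 * (w / 2 - i) := by ring
      rw [h5, norm_mul, h2]
      norm_num at h4 ⊢
      linarith
    interval_cases i
    · exact ⟨n, w, by simpa using h3, Or.inl hu'⟩
    · refine ⟨n, -2 - w, ?_, Or.inr (by rw [hu']; ring)⟩
      have h4 : ‖(2 * 2 : L)‖ ≤ 1 / 8 := by rw [norm_mul, h2]; norm_num
      have h5 : -2 - w = -(2 * 2 + (w - 2 * (1 : ℕ))) := by push_cast; ring
      rw [h5, norm_neg]
      exact norm_add_le_of_le h4 h3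

variable {m : ℤ} {s : L} (hs2 : s ^ 2 = m)
include hs2

/-- Expanding with s² = m, (1 + s)⁴ - 1 = 4s + 4ms + m(6 + m) = 4(s + 2a + ms), and ms is in the
disc for even m. -/
lemma norm_logSeries_sub_two_even (hs : ‖s‖ = ((2 : ℕ) : ℝ)⁻¹) {a : ℤ}
    (hm : m * (6 + m) = 8 * a) (hm2 : 2 ∣ m) : ‖logSeries (1 + s) - (s + 2 * a)‖ ≤ 1 / 8 := by
  have : Fact (Nat.Prime 2) := ⟨Nat.prime_two⟩
  have hρ := isLogRadius_two hL.norm_prime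
  have h8 : ((2 : ℕ) : ℝ)⁻¹ ^ 3 = 1 / 8 := by norm_num
  have h2 : ‖(2 : L)‖ = 1 / 4 := by have := hL.norm_prime; norm_num at this; rw [this]
  have hs' : ‖s‖ = 1 / 2 := by rw [hs]; norm_num
  rw [h8] at hρ
  have hm' : (m : L) * (6 + m) = 8 * a := by exact_mod_cast congrArg (Int.cast (R := L)) hm
  have h4 : ‖((4 : ℕ) : L)‖ = 1 / 16 := by
    have : ((4 : ℕ) : L) = 2 * 2 := by norm_num
    rw [this, norm_mul, h2]; norm_num
  have hw : (1 + s) ^ 4 - 1 = ((4 : ℕ) : L) * (s + 2 * a + (m : L) * s) := by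
    push_cast
    linear_combination (4 * s + 6 + s ^ 2 + m) * hs2 + hm'
  obtain ⟨b, hb⟩ := hm2
  have hms : ‖(m : L) * s‖ ≤ 1 / 8 := by
    have : (m : L) * s = b * (2 * s) := by rw [hb]; push_cast; ring
    rw [this]
    refine norm_intCast_mul_le b ?_
    rw [norm_mul, h2, hs']; norm_num
  have h5 : ‖s + 2 * a + (m : L) * s‖ ≤ 1 / 2 := by
    refine norm_add_le_of_le (norm_add_le_of_le hs'.le ?_) (hms.trans (by norm_num))
    rw [mul_comm]
    exact norm_intCast_mul_le a (h2.le.trans (by norm_num))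
  have h6 := norm_logSeries_sub_le_of_pow hL.norm_prime hρ (g := 1 + s)
    (by rw [add_sub_cancel_left, hs']; norm_num) (n := 4) (by norm_num) (r := 1 / 32)
    (by rw [hw, norm_mul, h4]; linarith) (by norm_num) (by rw [h2, h4]; norm_num)
  rw [hw, mul_div_cancel_left₀ _ (Nat.cast_ne_zero.2 (by norm_num))] at h6
  have h7 : logSeries (1 + s) - (s + 2 * a) =
      (logSeries (1 + s) - (s + 2 * a + (m : L) * s)) + (m : L) * s := by ring
  rw [h7]
  exact norm_add_le_of_le h6 hms

/-- Now s itself is a principal unit, and s⁴ - 1 = m² - 1 = 8a. -/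
lemma norm_logSeries_sub_two_odd (hs : ‖s - 1‖ = ((2 : ℕ) : ℝ)⁻¹) {a : ℤ}
    (hm : m ^ 2 - 1 = 8 * a) : ‖logSeries s - 2 * a‖ ≤ 1 / 8 := by
  have : Fact (Nat.Prime 2) := ⟨Nat.prime_two⟩
  have hρ := isLogRadius_two hL.norm_prime
  have h8 : ((2 : ℕ) : ℝ)⁻¹ ^ 3 = 1 / 8 := by norm_num
  have h2 : ‖(2 : L)‖ = 1 / 4 := by have := hL.norm_prime; norm_num at this; rw [this]
  rw [h8] at hρ
  have hm' : (m : L) ^ 2 - 1 = 8 * a := by exact_mod_cast congrArg (Int.cast (R := L)) hm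
  have h4 : ‖((4 : ℕ) : L)‖ = 1 / 16 := by
    have : ((4 : ℕ) : L) = 2 * 2 := by norm_num
    rw [this, norm_mul, h2]; norm_num
  have hw : s ^ 4 - 1 = ((4 : ℕ) : L) * (2 * a) := by
    push_cast
    linear_combination (s ^ 2 + m) * hs2 + hm'
  have h5 : ‖(2 * a : L)‖ ≤ 1 / 4 := by
    rw [mul_comm]
    exact norm_intCast_mul_le a h2.le
  have h6 := norm_logSeries_sub_le_of_pow hL.norm_prime hρ (g := s)
    (by rw [hs]; norm_num) (n := 4) (by norm_num) (r := 1 / 64)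
    (by rw [hw, norm_mul, h4]; linarith) (by norm_num) (by rw [h2, h4]; norm_num)
  rwa [hw, mul_div_cancel_left₀ _ (Nat.cast_ne_zero.2 (by norm_num))] at h6

variable [Fact (Nat.Prime 2)]

/-- For m ≡ 2 the integer a is even, so log(1 + s) ≡ s modulo the disc. -/
lemma logSeries_image_two_of_mod_eight_eq_two (hs : ‖s‖ = ((2 : ℕ) : ℝ)⁻¹) (hm : m % 8 = 2)
    (c : ℚ_[2]) : padicEmbedding hL.norm_prime c * s ∈ logSeries '' unitDisc L ↔ ‖c‖ ≤ 1 := by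
  obtain ⟨k, rfl⟩ : ∃ k, m = 8 * k + 2 := ⟨m / 8, by lia⟩
  have hs' : ‖s‖ = 1 / 2 := by rw [hs]; norm_num
  have h2 : ‖(2 : L)‖ = 1 / 4 := by have := hL.norm_prime; norm_num at this; rw [this]
  have hℓ : ‖logSeries (1 + s) - s‖ ≤ 1 / 8 := by
    have h1 := norm_logSeries_sub_two_even hL hs2 hs (a := 2 * ((4 * k + 1) * (k + 1))) (by ring)
      (by lia)
    have h3 : ‖(((4 * k + 1) * (k + 1) : ℤ) : L) * (2 * 2)‖ ≤ 1 / 8 := by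
      refine norm_intCast_mul_le _ ?_
      rw [norm_mul, h2]
      norm_num
    convert norm_add_le_of_le h1 h3 using 2
    push_cast
    ring
  rw [mem_logSeries_image_iff_two hL (g := 1 + s) (by rwa [add_sub_cancel_left]) hℓ]
  have key : ∀ n : ℤ, ‖padicEmbedding hL.norm_prime c * s - n * s‖ = ‖c - n‖ ^ 2 * (1 / 2) := by
    intro n
    rw [← sub_mul, ← map_intCast (padicEmbedding hL.norm_prime), ← map_sub, norm_mul,
      norm_padicEmbedding, hs']
  simp_rw [key]
  constructor
  · rintro ⟨n, hn⟩
    have h1 : ‖c - n‖ ≤ 1 := by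
      rw [← sq_le_one_iff₀ (norm_nonneg _)]
      linarith
    have := norm_add_le_of_le h1 (IsUltrametricDist.norm_intCast_le_one ℚ_[2] n)
    rwa [sub_add_cancel] at this
  · intro hc
    obtain ⟨n, hn⟩ := exists_int_norm_sub_le hc
    refine ⟨n, ?_⟩
    norm_num at hn ⊢
    nlinarith [norm_nonneg (c - n)]

omit hL hs2 in
lemma norm_two_padic : ‖(2 : ℚ_[2])‖ = 1 / 2 := by
  simpa using Padic.norm_p (p := 2)

omit hL hs2 in
lemma norm_intCast_two_eq_one_or (n : ℤ) : ‖(n : ℚ_[2])‖ = 1 ∨ ‖(n : ℚ_[2])‖ ≤ 1 / 2 := by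
  rcases Int.even_or_odd' n with ⟨a, rfl | rfl⟩
  · right
    push_cast
    rw [norm_mul, norm_two_padic]
    have := IsUltrametricDist.norm_intCast_le_one ℚ_[2] a
    linarith
  · left
    have := IsUltrametricDist.norm_intCast_le_one ℚ_[2] a
    refine norm_eq_one_of_norm_sub_one_lt ?_
    push_cast
    rw [add_sub_cancel_right, norm_mul, norm_two_padic]
    linarith

/-- For m ≡ 6 the integer a is odd and log(1 + s) ≡ s + 2. Multiples n(s + 2) approach the line only
for even n, whence the factor 2. -/
lemma logSeries_image_two_of_mod_eight_eq_six (hs : ‖s‖ = ((2 : ℕ) : ℝ)⁻¹) (hm : m % 8 = 6)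
    (c : ℚ_[2]) :
    padicEmbedding hL.norm_prime c * (2 * s) ∈ logSeries '' unitDisc L ↔ ‖c‖ ≤ 1 := by
  obtain ⟨k, rfl⟩ : ∃ k, m = 8 * k + 6 := ⟨m / 8, by lia⟩
  have h2 : ‖(2 : L)‖ = 1 / 4 := by have := hL.norm_prime; norm_num at this; rw [this]
  have hℓ : ‖logSeries (1 + s) - (s + 2)‖ ≤ 1 / 8 := by
    have h1 := norm_logSeries_sub_two_even hL hs2 hs (a := (4 * k + 3) * (2 * k + 3)) (by ring)
      (by lia)
    have h3 : ‖((4 * k ^ 2 + 9 * k + 4 : ℤ) : L) * (2 * 2)‖ ≤ 1 / 8 := by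
      refine norm_intCast_mul_le _ ?_
      rw [norm_mul, h2]
      norm_num
    convert norm_add_le_of_le h1 h3 using 2
    push_cast
    ring
  rw [mem_logSeries_image_iff_two hL (g := 1 + s) (by rwa [add_sub_cancel_left]) hℓ]
  have key : ∀ n : ℤ, ‖padicEmbedding hL.norm_prime c * (2 * s) - n * (s + 2)‖ =
      max (‖(n : ℚ_[2])‖ ^ 2 * (1 / 4)) (‖2 * c - n‖ ^ 2 * (1 / 2)) := by
    intro n
    have h3 : padicEmbedding hL.norm_prime c * (2 * s) - n * (s + 2) =
        padicEmbedding hL.norm_prime (-(n * 2)) + padicEmbedding hL.norm_prime (2 * c - n) * s := by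
      simp only [map_neg, map_sub, map_mul, map_intCast, map_ofNat]
      ring
    rw [h3, norm_padicEmbedding_add_mul hL.norm_prime hs, norm_neg, norm_mul, norm_two_padic]
    norm_num [mul_pow]
  simp_rw [key]
  constructor
  · rintro ⟨n, hn⟩
    have h3 := (le_max_left _ _).trans hn
    have h4 := (le_max_right _ _).trans hn
    have h5 : ‖(n : ℚ_[2])‖ ≤ 1 / 2 := by
      refine (norm_intCast_two_eq_one_or n).resolve_left fun h => ?_
      rw [h] at h3
      norm_num at h3
    have h6 : ‖2 * c - n‖ ≤ 1 / 2 := by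
      by_contra! h
      nlinarith
    have h7 := norm_add_le_of_le h6 h5
    rw [sub_add_cancel, norm_mul, norm_two_padic] at h7
    linarith
  · intro hc
    refine ⟨0, max_le (by norm_num) ?_⟩
    have : ‖c‖ ^ 2 ≤ 1 := pow_le_one₀ (norm_nonneg c) hc
    rw [Int.cast_zero, sub_zero, norm_mul, norm_two_padic]
    linarith

/-- For m ≡ 7 the integer a is even and log s is absorbed: log U is the disc of radius 1/8, and
‖4cs‖ = ‖c‖²/16. -/
lemma logSeries_image_two_of_mod_eight_eq_seven (hs : ‖s - 1‖ = ((2 : ℕ) : ℝ)⁻¹) (hm : m % 8 = 7)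
    (c : ℚ_[2]) :
    padicEmbedding hL.norm_prime c * (4 * s) ∈ logSeries '' unitDisc L ↔ ‖c‖ ≤ 1 := by
  obtain ⟨k, rfl⟩ : ∃ k, m = 8 * k + 7 := ⟨m / 8, by lia⟩
  have h2 : ‖(2 : L)‖ = 1 / 4 := by have := hL.norm_prime; norm_num at this; rw [this]
  have h4 : (4 : L) = 2 * 2 := by norm_num
  have hs1 : ‖s‖ = 1 := norm_eq_one_of_norm_sub_one_lt (by rw [hs]; norm_num)
  have hℓ : ‖logSeries s - 0‖ ≤ 1 / 8 := by
    have h1 := norm_logSeries_sub_two_odd hL hs2 hs (a := 2 * ((4 * k + 3) * (k + 1))) (by ring)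
    have h3 : ‖(((4 * k + 3) * (k + 1) : ℤ) : L) * (2 * 2)‖ ≤ 1 / 8 := by
      refine norm_intCast_mul_le _ ?_
      rw [norm_mul, h2]
      norm_num
    convert norm_add_le_of_le h1 h3 using 2
    push_cast
    ring
  rw [mem_logSeries_image_iff_two hL hs hℓ, ← norm_sq_mul_inv_le_one_iff c]
  simp only [mul_zero, sub_zero, exists_const, norm_mul, norm_padicEmbedding, hs1, h4, h2]
  norm_num
  constructor <;> intro h <;> linarith

/-- For m ≡ 3 the integer a is odd and log s ≡ 2, which is ≡ 2s since ‖2(s - 1)‖ = 1/8. Norms are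
computed in the orthogonal basis 1, s - 1. -/
lemma logSeries_image_two_of_mod_eight_eq_three (hs : ‖s - 1‖ = ((2 : ℕ) : ℝ)⁻¹) (hm : m % 8 = 3)
    (c : ℚ_[2]) :
    padicEmbedding hL.norm_prime c * (2 * s) ∈ logSeries '' unitDisc L ↔ ‖c‖ ≤ 1 := by
  obtain ⟨k, rfl⟩ : ∃ k, m = 8 * k + 3 := ⟨m / 8, by lia⟩
  have h2 : ‖(2 : L)‖ = 1 / 4 := by have := hL.norm_prime; norm_num at this; rw [this]
  have hℓ : ‖logSeries s - 2‖ ≤ 1 / 8 := by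
    have h1 := norm_logSeries_sub_two_odd hL hs2 hs (a := (4 * k + 1) * (2 * k + 1)) (by ring)
    have h3 : ‖((4 * k ^ 2 + 3 * k : ℤ) : L) * (2 * 2)‖ ≤ 1 / 8 := by
      refine norm_intCast_mul_le _ ?_
      rw [norm_mul, h2]
      norm_num
    convert norm_add_le_of_le h1 h3 using 2
    push_cast
    ring
  rw [mem_logSeries_image_iff_two hL hs hℓ]
  have key : ∀ n : ℤ, ‖padicEmbedding hL.norm_prime c * (2 * s) - n * 2‖ =
      max (‖c - n‖ ^ 2 * (1 / 4)) (‖c‖ ^ 2 * (1 / 8)) := by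
    intro n
    have h3 : padicEmbedding hL.norm_prime c * (2 * s) - n * 2 =
        padicEmbedding hL.norm_prime (2 * (c - n)) +
          padicEmbedding hL.norm_prime (2 * c) * (s - 1) := by
      simp only [map_sub, map_mul, map_intCast, map_ofNat]
      ring
    rw [h3, norm_padicEmbedding_add_mul hL.norm_prime hs, norm_mul, norm_mul, norm_two_padic]
    congr 1 <;> norm_num [mul_pow] <;> ring
  simp_rw [key]
  constructor
  · rintro ⟨n, hn⟩
    have h4 := (le_max_right _ _).trans hn
    rw [← sq_le_one_iff₀ (norm_nonneg _)]
    linarith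
  · intro hc
    obtain ⟨n, hn⟩ := exists_int_norm_sub_le hc
    refine ⟨n, max_le ?_ ?_⟩
    · norm_num at hn ⊢
      nlinarith [norm_nonneg (c - n)]
    · have : ‖c‖ ^ 2 ≤ 1 := pow_le_one₀ (norm_nonneg c) hc
      linarith

end Two

end Lattice

/-! ### Norm, trace and discriminant of ℚ(√m) -/

section QuadraticField

variable {K : Type*} [Field K] [NumberField K] {m : ℤ} {s : K}

lemma not_isSquare_of_squarefree (hm : Squarefree m) (hm1 : 1 < m) : ¬ IsSquare m := by
  rintro ⟨a, rfl⟩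
  have ha := Int.isUnit_iff.1 (hm a dvd_rfl)
  rcases ha with rfl | rfl <;> norm_num at hm1

lemma intCast_rat_sq_ne (hm : Squarefree m) (hm1 : 1 < m) (r : ℚ) : r ^ 2 ≠ m := by
  intro h
  refine not_isSquare_of_squarefree hm hm1 (Rat.isSquare_intCast_iff.1 ⟨r, ?_⟩)
  rw [← h, sq]

lemma finrank_eq_two (hm : Squarefree m) (hm1 : 1 < m) (hs : s ^ 2 = m)
    (hK : IntermediateField.adjoin ℚ {s} = ⊤) : Module.finrank ℚ K = 2 := by
  have hmin : minpoly ℚ s = Polynomial.X ^ 2 - Polynomial.C (m : ℚ) := by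
    refine (minpoly.eq_of_irreducible_of_monic ?_ (by simp [hs])
      (Polynomial.monic_X_pow_sub_C _ two_ne_zero)).symm
    exact X_pow_sub_C_irreducible_of_prime Nat.prime_two fun b => intCast_rat_sq_ne hm hm1 b
  rw [← IntermediateField.finrank_top', ← hK, IntermediateField.adjoin.finrank
    (Algebra.IsIntegral.isIntegral s), hmin, Polynomial.natDegree_X_pow_sub_C]

lemma linearIndependent_one_sqrt (hm : Squarefree m) (hm1 : 1 < m) (hs : s ^ 2 = m) :
    LinearIndependent ℚ ![(1 : K), s] := by
  rw [LinearIndependent.pair_iff]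
  intro a b hab
  have hb : b = 0 := by
    by_contra hb
    refine intCast_rat_sq_ne hm hm1 (-a / b) ?_
    have h1 : s = ((-a / b : ℚ) : K) := by
      have hb' : (b : K) ≠ 0 := Rat.cast_ne_zero.2 hb
      push_cast
      rw [eq_div_iff hb']
      rw [Rat.smul_def, Rat.smul_def] at hab
      linear_combination hab
    rw [h1] at hs
    exact_mod_cast hs
  subst hb
  simpa using hab

/-- The basis `1, √m` of `ℚ(√m)`. -/
noncomputable def sqrtBasis (hm : Squarefree m) (hm1 : 1 < m) (hs : s ^ 2 = m)
    (hK : IntermediateField.adjoin ℚ {s} = ⊤) : Module.Basis (Fin 2) ℚ K :=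
  basisOfLinearIndependentOfCardEqFinrank (linearIndependent_one_sqrt hm hm1 hs)
    (by rw [finrank_eq_two hm hm1 hs hK, Fintype.card_fin])

lemma exists_eq_add_mul_sqrt (hm : Squarefree m) (hm1 : 1 < m) (hs : s ^ 2 = m)
    (hK : IntermediateField.adjoin ℚ {s} = ⊤) (x : K) : ∃ a b : ℚ, x = a + b * s := by
  have h := (sqrtBasis hm hm1 hs hK).sum_repr x
  rw [Fin.sum_univ_two] at h
  refine ⟨(sqrtBasis hm hm1 hs hK).repr x 0, (sqrtBasis hm hm1 hs hK).repr x 1, h.symm.trans ?_⟩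
  have h0 : sqrtBasis hm hm1 hs hK 0 = 1 := by simp [sqrtBasis]
  have h1 : sqrtBasis hm hm1 hs hK 1 = s := by simp [sqrtBasis]
  rw [h0, h1, Rat.smul_def, Rat.smul_def, mul_one]

lemma leftMulMatrix_sqrtBasis (hm : Squarefree m) (hm1 : 1 < m) (hs : s ^ 2 = m)
    (hK : IntermediateField.adjoin ℚ {s} = ⊤) (a b : ℚ) :
    Algebra.leftMulMatrix (sqrtBasis hm hm1 hs hK) ((a : K) + b * s) = !![a, b * m; b, a] := by
  set B := sqrtBasis hm hm1 hs hK with hB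
  have h0 : B 0 = 1 := by simp [hB, sqrtBasis]
  have h1 : B 1 = s := by simp [hB, sqrtBasis]
  have e0 : ((a : K) + b * s) * B 0 = a • B 0 + b • B 1 := by
    rw [h0, h1, Rat.smul_def, Rat.smul_def]; ring
  have e1 : ((a : K) + b * s) * B 1 = (b * m) • B 0 + a • B 1 := by
    rw [h0, h1, Rat.smul_def, Rat.smul_def]
    push_cast
    linear_combination (b : K) * hs
  ext i j
  rw [Algebra.leftMulMatrix_eq_repr_mul]
  fin_cases i <;> fin_cases j <;> simp [e0, e1]

lemma norm_add_mul_sqrt (hm : Squarefree m) (hm1 : 1 < m) (hs : s ^ 2 = m)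
    (hK : IntermediateField.adjoin ℚ {s} = ⊤) (a b : ℚ) :
    Algebra.norm ℚ ((a : K) + b * s) = a ^ 2 - b ^ 2 * m := by
  rw [Algebra.norm_eq_matrix_det (sqrtBasis hm hm1 hs hK), leftMulMatrix_sqrtBasis,
    Matrix.det_fin_two_of]
  ring

lemma trace_add_mul_sqrt (hm : Squarefree m) (hm1 : 1 < m) (hs : s ^ 2 = m)
    (hK : IntermediateField.adjoin ℚ {s} = ⊤) (a b : ℚ) :
    Algebra.trace ℚ K ((a : K) + b * s) = 2 * a := by
  rw [Algebra.trace_eq_matrix_trace (sqrtBasis hm hm1 hs hK), leftMulMatrix_sqrtBasis,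
    Matrix.trace_fin_two_of]
  ring

/-- The discriminant of `K` divides the discriminant of `1, x` for every integer `x` of `K`. -/
lemma discr_dvd_of_isIntegral (hm : Squarefree m) (hm1 : 1 < m) (hs : s ^ 2 = m)
    (hK : IntermediateField.adjoin ℚ {s} = ⊤) {a b : ℚ} (hx : IsIntegral ℤ ((a : K) + b * s))
    {d : ℤ} (hd : (d : ℚ) = 4 * m * b ^ 2) : NumberField.discr K ∣ d := by
  let x : 𝓞 K := ⟨(a : K) + b * s, hx⟩
  have hcard : Fintype.card (Module.Free.ChooseBasisIndex ℤ (𝓞 K)) = 2 := by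
    rw [← Module.finrank_eq_card_chooseBasisIndex, RingOfIntegers.rank, finrank_eq_two hm hm1 hs hK]
  let e := Fintype.equivFinOfCardEq hcard
  let B := (RingOfIntegers.basis K).reindex e
  have hB : NumberField.discr K = Algebra.discr ℤ B := (NumberField.discr_eq_discr K B).symm
  have hv : Algebra.discr ℤ ![1, x] = d := by
    have h1 : (Algebra.discr ℤ ![1, x] : ℚ) = d := by
      have t : ∀ y : 𝓞 K, ((Algebra.trace ℤ (𝓞 K) y : ℤ) : ℚ) = Algebra.trace ℚ K (y : K) :=
        fun y => Algebra.coe_trace_int y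
      have t1 : Algebra.trace ℚ K (1 : K) = 2 := by
        have := trace_add_mul_sqrt hm hm1 hs hK 1 0
        simpa using this
      have t2 : Algebra.trace ℚ K ((x : 𝓞 K) : K) = 2 * a := trace_add_mul_sqrt hm hm1 hs hK a b
      have t3 : Algebra.trace ℚ K (((x * x : 𝓞 K)) : K) = 2 * (a ^ 2 + m * b ^ 2) := by
        rw [← trace_add_mul_sqrt hm hm1 hs hK (a ^ 2 + m * b ^ 2) (2 * a * b)]
        congr 1
        change ((a : K) + b * s) * ((a : K) + b * s) = _
        push_cast
        linear_combination (b : K) ^ 2 * hs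
      rw [Algebra.discr_def, Matrix.det_fin_two]
      simp only [Algebra.traceMatrix_apply, Algebra.traceForm_apply, Matrix.cons_val_zero,
        Matrix.cons_val_one, mul_one, one_mul]
      push_cast
      rw [t, t, t, t2, t3, show ((1 : 𝓞 K) : K) = 1 from rfl, t1, hd]
      ring
    exact_mod_cast h1
  -- Passing from an integral basis to 1, x multiplies the discriminant by the square of an integer
  -- determinant.
  have hmul : ![1, x] = Matrix.mulVec ((B.toMatrix ![1, x]).transpose.map (algebraMap ℤ (𝓞 K))) B := by
    funext i
    have := B.sum_toMatrix_smul_self ![1, x] i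
    rw [← this, Matrix.mulVec, dotProduct]
    refine Finset.sum_congr rfl fun j _ => ?_
    simp [Matrix.map_apply, zsmul_eq_mul]
  rw [hB, ← hv, hmul, Algebra.discr_of_matrix_mulVec]
  exact dvd_mul_left _ _

omit [NumberField K] in
lemma isIntegral_sqrt (hs : s ^ 2 = m) : IsIntegral ℤ s :=
  ⟨Polynomial.X ^ 2 - Polynomial.C m, Polynomial.monic_X_pow_sub_C _ two_ne_zero, by
    rw [Polynomial.eval₂_sub, Polynomial.eval₂_pow, Polynomial.eval₂_X, Polynomial.eval₂_C, hs,
      eq_intCast, sub_self]⟩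

/-- A prime dividing the discriminant of `ℚ(√m)` divides `m`, or is `2` with `m ≡ 3 mod 4`. -/
lemma dvd_or_of_dvd_discr (hm : Squarefree m) (hm1 : 1 < m) (hs : s ^ 2 = m)
    (hK : IntermediateField.adjoin ℚ {s} = ⊤) {p : ℕ} (hp : p.Prime)
    (hpD : (p : ℤ) ∣ NumberField.discr K) : (p : ℤ) ∣ m ∨ p = 2 ∧ m % 4 = 3 := by
  have hp' := Nat.prime_iff_prime_int.1 hp
  have h1 : (p : ℤ) ∣ 4 * m := hpD.trans
    (discr_dvd_of_isIntegral hm hm1 hs hK (a := 0) (b := 1) (by simpa using isIntegral_sqrt hs)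
      (by push_cast; ring))
  rcases hp'.dvd_or_dvd h1 with h | h
  · have hp2 : p = 2 := by
      have : (p : ℤ) ∣ 2 ^ 2 := by norm_num; exact h
      have := hp'.dvd_of_dvd_pow this
      exact (Nat.prime_dvd_prime_iff_eq hp Nat.prime_two).1 (by exact_mod_cast this)
    subst hp2
    by_cases hm2 : ((2 : ℕ) : ℤ) ∣ m
    · exact Or.inl hm2
    refine Or.inr ⟨rfl, ?_⟩
    push_cast at hm2
    by_contra hm3
    have hm4 : m % 4 = 1 := by lia
    obtain ⟨k, hk⟩ : ∃ k, m = 4 * k + 1 := ⟨m / 4, by lia⟩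
    have hmk : (m : K) = 4 * k + 1 := by exact_mod_cast congrArg (Int.cast (R := K)) hk
    -- For m ≡ 1 mod 4, (1 + √m)/2 is integral and 1, (1 + √m)/2 has odd discriminant m, so 2 cannot
    -- divide D_K.
    have hint : IsIntegral ℤ (((1 / 2 : ℚ) : K) + ((1 / 2 : ℚ) : K) * s) := by
      refine ⟨Polynomial.X ^ 2 - Polynomial.X - Polynomial.C k, ?_, ?_⟩
      · monicity!
      · rw [Polynomial.eval₂_sub, Polynomial.eval₂_sub, Polynomial.eval₂_pow, Polynomial.eval₂_X,
          Polynomial.eval₂_C, eq_intCast]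
        push_cast
        linear_combination (1 / 4 : K) * hs + (1 / 4 : K) * hmk
    have := hpD.trans (discr_dvd_of_isIntegral hm hm1 hs hK hint (d := m) (by ring))
    exact hm2 (by exact_mod_cast this)
  · exact Or.inl h

end QuadraticField

/-! ### Ramification at primes dividing the discriminant -/

section Ramification

variable {K : Type*} [Field K] [NumberField K] {p : ℕ}

lemma absNorm_span_prime (h2 : Module.finrank ℚ K = 2) :
    Ideal.absNorm (Ideal.span {(p : 𝓞 K)}) = p ^ 2 := by
  rw [Ideal.absNorm_span_singleton]
  have h := Algebra.norm_algebraMap_of_basis (RingOfIntegers.basis K) (p : ℤ)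
  rw [← Module.finrank_eq_card_chooseBasisIndex, RingOfIntegers.rank, h2] at h
  rw [map_natCast] at h
  rw [h]
  simp [Int.natAbs_pow]

/-- If `p` is, up to a unit at `𝔭`, the square of an integer `π` of a quadratic field, then `𝔭` is
totally ramified with uniformizer `π`. -/
lemma absNorm_eq_of_sq (h2 : Module.finrank ℚ K = 2) (hp : p.Prime)
    {𝔭 : HeightOneSpectrum (𝓞 K)} (hp𝔭 : (p : 𝓞 K) ∈ 𝔭.asIdeal) {π u : 𝓞 K}
    (hπ : π ^ 2 = p * u) (hu : u ∉ 𝔭.asIdeal) :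
    Ideal.absNorm 𝔭.asIdeal = p ∧ 𝔭.intValuation π = WithZero.exp (-1 : ℤ) ∧
      Ideal.span {(p : 𝓞 K)} = 𝔭.asIdeal ^ 2 := by
  have hp0 : (p : 𝓞 K) ≠ 0 := Nat.cast_ne_zero.2 hp.ne_zero
  have hu0 : u ≠ 0 := fun h => hu (h ▸ zero_mem _)
  have hπ0 : π ≠ 0 := by
    rintro rfl
    rw [zero_pow two_ne_zero] at hπ
    exact mul_ne_zero hp0 hu0 hπ.symm
  have hvu : 𝔭.intValuation u = 1 := HeightOneSpectrum.intValuation_eq_one_iff.2 hu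
  set k := multiplicity 𝔭.asIdeal (Ideal.span {π}) with hk
  have hvπ := 𝔭.intValuation_eq_exp_neg_multiplicity hπ0
  rw [← hk] at hvπ
  have hvp : 𝔭.intValuation (p : 𝓞 K) = WithZero.exp (-((2 * k : ℕ) : ℤ)) := by
    have h := congrArg 𝔭.intValuation hπ
    rw [map_mul, hvu, mul_one, map_pow, hvπ, ← WithZero.exp_nsmul] at h
    rw [← h]
    congr 1
    simp
  have hk1 : 1 ≤ k := by
    rw [Nat.one_le_iff_ne_zero]
    intro hk0
    have h := (𝔭.intValuation_lt_one_iff_mem _).2 hp𝔭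
    rw [hvp, hk0] at h
    simp at h
  have hmem : (p : 𝓞 K) ∈ 𝔭.asIdeal ^ (2 * k) := (𝔭.intValuation_le_pow_iff_mem _ _).1 hvp.le
  have hdvd : 𝔭.asIdeal ^ (2 * k) ∣ Ideal.span {(p : 𝓞 K)} :=
    Ideal.dvd_iff_le.2 ((Ideal.span_singleton_le_iff_mem _).2 hmem)
  -- With N𝔭 = p^j and v(π) = k, both positive, divisibility of p² by p^(2jk) leaves only j = k = 1.
  have hnorm : Ideal.absNorm 𝔭.asIdeal ^ (2 * k) ∣ p ^ 2 := by
    have := map_dvd Ideal.absNorm hdvd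
    rwa [map_pow, absNorm_span_prime h2] at this
  have hone := NumberField.HeightOneSpectrum.one_lt_absNorm 𝔭
  obtain ⟨j, hj, hNj⟩ := (Nat.dvd_prime_pow hp).1
    ((dvd_pow_self (Ideal.absNorm 𝔭.asIdeal) (by lia : 2 * k ≠ 0)).trans hnorm)
  have hj0 : j ≠ 0 := by
    rintro rfl
    simp [hNj] at hone
  rw [hNj, ← pow_mul, Nat.pow_dvd_pow_iff_le_right hp.one_lt] at hnorm
  have hjk : j = 1 ∧ k = 1 := by
    have h1 : 1 ≤ j := Nat.one_le_iff_ne_zero.2 hj0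
    constructor <;> nlinarith
  obtain ⟨rfl, hk1⟩ := hjk
  rw [hk1] at hvπ hdvd
  rw [pow_one] at hNj
  refine ⟨hNj, by simpa using hvπ, ?_⟩
  obtain ⟨J, hJ⟩ := hdvd
  have hN := congrArg Ideal.absNorm hJ
  rw [absNorm_span_prime h2, map_mul, map_pow, hNj] at hN
  have hJ1 : Ideal.absNorm J = 1 :=
    (Nat.eq_of_mul_eq_mul_left (pow_pos hp.pos 2) (by simpa using hN)).symm
  rw [Ideal.absNorm_eq_one_iff.1 hJ1] at hJ
  simpa using hJ

lemma eq_of_mem_of_span_eq_sq {𝔭 𝔮 : HeightOneSpectrum (𝓞 K)}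
    (h : Ideal.span {(p : 𝓞 K)} = 𝔭.asIdeal ^ 2) (h𝔮 : (p : 𝓞 K) ∈ 𝔮.asIdeal) : 𝔮 = 𝔭 := by
  have h1 : 𝔭.asIdeal ^ 2 ≤ 𝔮.asIdeal := h ▸ (Ideal.span_singleton_le_iff_mem _).2 h𝔮
  exact (HeightOneSpectrum.ext
    (𝔭.isMaximal.eq_of_le 𝔮.isPrime.ne_top (𝔮.isPrime.le_of_pow_le h1))).symm

variable {m : ℤ} {s : K}

/-- A prime dividing the discriminant of `ℚ(√m)` is up to a local unit the square of `√m` or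
`√m - 1`. -/
lemma exists_sq_eq_mul (hm : Squarefree m) {S : 𝓞 K} (hS : S ^ 2 = (m : 𝓞 K)) (hp : p.Prime)
    (h : (p : ℤ) ∣ m ∨ p = 2 ∧ m % 4 = 3) {𝔭 : HeightOneSpectrum (𝓞 K)}
    (hp𝔭 : (p : 𝓞 K) ∈ 𝔭.asIdeal) :
    ∃ u ∉ 𝔭.asIdeal, (S - (if (p : ℤ) ∣ m then 0 else 1)) ^ 2 = p * u := by
  have := 𝔭.isPrime
  have hint : ∀ n : ℤ, ¬ (p : ℤ) ∣ n → (n : 𝓞 K) ∉ 𝔭.asIdeal := by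
    intro n hn hmem
    have hcop : IsCoprime (p : ℤ) n :=
      (Prime.coprime_iff_not_dvd (Nat.prime_iff_prime_int.1 hp)).2 hn
    obtain ⟨a, b, hab⟩ := hcop
    have h1 : (a : 𝓞 K) * p + b * n = 1 := by
      exact_mod_cast congrArg (Int.cast (R := 𝓞 K)) hab
    exact 𝔭.isPrime.ne_top ((Ideal.eq_top_iff_one _).2
      (h1 ▸ add_mem (Ideal.mul_mem_left _ _ hp𝔭) (Ideal.mul_mem_left _ _ hmem)))
  split_ifs with hpm
  · obtain ⟨n, rfl⟩ := hpm
    refine ⟨n, hint n ?_, by rw [sub_zero, hS]; push_cast; ring⟩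
    rintro ⟨n', rfl⟩
    have := hm p ⟨n', by ring⟩
    exact (Nat.prime_iff_prime_int.1 hp).not_isUnit this
  · obtain ⟨rfl, hm3⟩ := h.resolve_left hpm
    obtain ⟨k, rfl⟩ : ∃ k, m = 4 * k + 3 := ⟨m / 4, by lia⟩
    -- For m = 4k + 3, (S - 1)² = m + 1 - 2S = 2(2(k + 1) - S).
    refine ⟨2 * (k + 1) - S, fun hmem => ?_, ?_⟩
    · have hSmem : S ∈ 𝔭.asIdeal := by
        have h1 : (2 : 𝓞 K) * (k + 1) ∈ 𝔭.asIdeal :=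
          Ideal.mul_mem_right _ _ (by exact_mod_cast hp𝔭)
        have := sub_mem h1 hmem
        rwa [sub_sub_cancel] at this
      have h2 : S ^ 2 ∈ 𝔭.asIdeal := Ideal.pow_mem_of_mem _ hSmem 2 two_pos
      rw [hS] at h2
      exact hint _ hpm h2
    · push_cast at hS ⊢
      linear_combination hS

end Ramification

/-! ### The completion at a ramified prime -/

section Completion

variable {K : Type*} [Field K] [NumberField K]

instance charZero_adicCompletion (𝔭 : HeightOneSpectrum (𝓞 K)) : CharZero (𝔭.adicCompletion K) :=
  charZero_of_injective_algebraMap (algebraMap K (𝔭.adicCompletion K)).injective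

lemma norm_eq_zpow_of_valued_eq (𝔭 : HeightOneSpectrum (𝓞 K)) {x : 𝔭.adicCompletion K} {n : ℤ}
    (h : Valued.v x = WithZero.exp n) : ‖x‖ = (Ideal.absNorm 𝔭.asIdeal : ℝ) ^ n := by
  rw [FinitePlace.norm_def, h, WithZeroMulInt.toNNReal_neg_apply _ WithZero.exp_ne_zero]
  push_cast
  rfl

lemma norm_lt_one_iff_valued_lt_one (𝔭 : HeightOneSpectrum (𝓞 K)) {x : 𝔭.adicCompletion K} :
    ‖x‖ < 1 ↔ Valued.v x < 1 := by
  rcases eq_or_ne x 0 with rfl | hx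
  · simp
  have hv : Valued.v x ≠ 0 := (Valuation.ne_zero_iff _).2 hx
  have h1 : (1 : ℝ) < Ideal.absNorm 𝔭.asIdeal := by
    exact_mod_cast NumberField.HeightOneSpectrum.one_lt_absNorm 𝔭
  rw [norm_eq_zpow_of_valued_eq 𝔭 (WithZero.exp_log hv).symm, zpow_lt_one_iff_right₀ h1,
    ← WithZero.exp_log hv, ← WithZero.exp_zero, WithZero.exp_lt_exp, WithZero.log_exp]

lemma valued_algebraMap (𝔭 : HeightOneSpectrum (𝓞 K)) (x : K) :
    Valued.v (algebraMap K (𝔭.adicCompletion K) x) = 𝔭.valuation K x :=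
  HeightOneSpectrum.valuedAdicCompletion_eq_valuation' 𝔭 x

/-- Approximate x by an element of K, that by a global integer, and that by a natural number, the
residue field being 𝔽_p. -/
lemma exists_norm_sub_natCast_lt_one {p : ℕ} (hp : p.Prime) {𝔭 : HeightOneSpectrum (𝓞 K)}
    (hN : Ideal.absNorm 𝔭.asIdeal = p) {x : 𝔭.adicCompletion K} (hx : ‖x‖ ≤ 1) :
    ∃ n : ℕ, n < p ∧ ‖x - n‖ < 1 := by
  obtain ⟨y, hy⟩ := (HeightOneSpectrum.denseRange_algebraMap K 𝔭).exists_dist_lt x one_pos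
  rw [dist_eq_norm_sub] at hy
  have hy1 : ‖algebraMap K (𝔭.adicCompletion K) y‖ ≤ 1 := by
    have := norm_sub_le_of_le hx hy.le
    rwa [sub_sub_cancel] at this
  have hvy : 𝔭.valuation K y ≤ 1 := by
    rw [← valued_algebraMap]
    by_contra! h
    have h2 : Valued.v (algebraMap K (𝔭.adicCompletion K) y)⁻¹ < 1 := by
      rw [map_inv₀]
      exact inv_lt_one_of_one_lt₀ h
    have h3 := (norm_lt_one_iff_valued_lt_one 𝔭).2 h2
    rw [norm_inv] at h3
    have h4 : 0 < ‖algebraMap K (𝔭.adicCompletion K) y‖ := by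
      rw [norm_pos_iff]
      intro h0
      rw [h0, map_zero] at h
      exact not_lt_zero h
    rw [inv_lt_one₀ h4] at h3
    linarith
  obtain ⟨a, ha⟩ := 𝔭.exists_valuation_sub_lt_of_integer hvy 1
  have hcard : Nat.card (𝓞 K ⧸ 𝔭.asIdeal) = p := by
    rw [← hN, Ideal.absNorm_apply]; rfl
  have : Finite (𝓞 K ⧸ 𝔭.asIdeal) := Nat.finite_of_card_ne_zero (hcard ▸ hp.ne_zero)
  have : Fintype (𝓞 K ⧸ 𝔭.asIdeal) := Fintype.ofFinite _
  have : Fact p.Prime := ⟨hp⟩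
  rw [Nat.card_eq_fintype_card] at hcard
  let e := ZMod.ringEquivOfPrime (𝓞 K ⧸ 𝔭.asIdeal) hp hcard
  obtain ⟨z, hz⟩ := e.surjective (Ideal.Quotient.mk _ a)
  refine ⟨z.val, ZMod.val_lt z, ?_⟩
  have hmem : a - (z.val : 𝓞 K) ∈ 𝔭.asIdeal := by
    rw [← Ideal.Quotient.eq, ← hz, map_natCast, ← map_natCast e, ZMod.natCast_zmod_val]
  have h1 : Valued.v (algebraMap K (𝔭.adicCompletion K) ((a - z.val : 𝓞 K) : K)) < 1 := by
    rw [valued_algebraMap]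
    exact (𝔭.valuation_lt_one_iff_mem _).2 hmem
  have h2 : Valued.v (algebraMap K (𝔭.adicCompletion K) ((a : K) - y)) < 1 := by
    rw [valued_algebraMap]
    exact ha
  rw [← norm_lt_one_iff_valued_lt_one] at h1 h2
  have h3 : x - (z.val : 𝔭.adicCompletion K) = (x - algebraMap K (𝔭.adicCompletion K) y) +
      (algebraMap K (𝔭.adicCompletion K) ((a - z.val : 𝓞 K) : K) -
        algebraMap K (𝔭.adicCompletion K) ((a : K) - y)) := by
    have hc : ((a - z.val : 𝓞 K) : K) = (a : K) - (z.val : K) := by push_cast; ring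
    rw [hc, map_sub, map_sub, map_natCast]
    ring
  rw [h3]
  refine (IsUltrametricDist.norm_add_le_max _ _).trans_lt (max_lt hy ?_)
  rw [sub_eq_add_neg]
  exact (IsUltrametricDist.norm_add_le_max _ _).trans_lt (max_lt h1 (by rwa [norm_neg]))

lemma isRamifiedQuadratic_adicCompletion {p : ℕ} (hp : p.Prime) {𝔭 : HeightOneSpectrum (𝓞 K)}
    (hN : Ideal.absNorm 𝔭.asIdeal = p) {π u : 𝓞 K} (hπ : π ^ 2 = p * u) (hu : u ∉ 𝔭.asIdeal)
    (hπ1 : 𝔭.intValuation π = WithZero.exp (-1 : ℤ)) :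
    IsRamifiedQuadratic p (𝔭.adicCompletion K) where
  norm_prime := by
    have h1 : Valued.v ((p : ℕ) : 𝔭.adicCompletion K) = WithZero.exp (-2 : ℤ) := by
      have h2 := congrArg 𝔭.intValuation hπ
      rw [map_mul, HeightOneSpectrum.intValuation_eq_one_iff.2 hu, mul_one, map_pow, hπ1,
        ← WithZero.exp_nsmul] at h2
      have h3 := valued_algebraMap 𝔭 (((p : ℕ) : 𝓞 K) : K)
      rw [HeightOneSpectrum.valuation_of_algebraMap, ← h2] at h3
      simpa using h3
    rw [norm_eq_zpow_of_valued_eq 𝔭 h1, hN, inv_pow]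
    rfl
  norm_le x hx := by
    rcases eq_or_ne x 0 with rfl | h0
    · simp
    have hv : Valued.v x ≠ 0 := (Valuation.ne_zero_iff _).2 h0
    rw [norm_lt_one_iff_valued_lt_one, ← WithZero.exp_log hv, ← WithZero.exp_zero,
      WithZero.exp_lt_exp] at hx
    rw [norm_eq_zpow_of_valued_eq 𝔭 (WithZero.exp_log hv).symm, hN, ← zpow_neg_one]
    exact zpow_le_zpow_right₀ (by exact_mod_cast hp.one_lt.le) (by lia)
  residue x hx := exists_norm_sub_natCast_lt_one hp hN hx

end Completion

/-! ### Fundamental units: infinite order and conjugation -/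

section Units

variable {K : Type*} [Field K] [NumberField K] {m : ℤ} {s : K}

/-- A fundamental unit of `ℚ(√m)` is not a root of unity, since the Pell equation is solvable. -/
lemma IsFundamentalUnit.pow_ne_one (hm : Squarefree m) (hm1 : 1 < m) (hs : s ^ 2 = m)
    {ε : (𝓞 K)ˣ} (hε : IsFundamentalUnit ε) {n : ℕ} (hn : n ≠ 0) : ε ^ n ≠ 1 := by
  intro h
  obtain ⟨x, y, hxy, hy⟩ := Pell.exists_of_not_isSquare (by lia) (not_isSquare_of_squarefree hm hm1)
  let S : 𝓞 K := ⟨s, isIntegral_sqrt hs⟩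
  have hS : S ^ 2 = (m : 𝓞 K) := RingOfIntegers.ext (by
    change s ^ 2 = ((m : 𝓞 K) : K)
    rw [hs]
    simp)
  have hxy' : (x : 𝓞 K) ^ 2 - m * y ^ 2 = 1 := by
    exact_mod_cast congrArg (Int.cast (R := 𝓞 K)) hxy
  -- A nontrivial Pell solution is a unit; if εⁿ = 1 then η^(2n) = 1, the factor 2 removing the
  -- sign.
  let η : (𝓞 K)ˣ := ⟨x + y * S, x - y * S, by linear_combination hxy' - (y : 𝓞 K) ^ 2 * hS,
    by linear_combination hxy' - (y : 𝓞 K) ^ 2 * hS⟩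
  have hη : η ^ (2 * n) = 1 := by
    obtain ⟨k, hk⟩ := hε η
    have h2 : η ^ 2 = (ε ^ k) ^ 2 := by
      rcases hk with hk | hk <;> rw [hk]
      rw [neg_sq]
    rw [pow_mul, h2, ← pow_mul, ← zpow_natCast, ← zpow_mul, mul_comm, mul_comm 2, Nat.cast_mul,
      mul_assoc, zpow_mul, zpow_natCast, h, one_zpow]
  -- Embedded in ℂ, η is real and a root of unity, so η² = 1. Hence x + yw equals its inverse x -
  -- yw, forcing y = 0.
  obtain ⟨φ⟩ : Nonempty (K →+* ℂ) := inferInstance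
  have hηC : (φ ((η : 𝓞 K) : K)) ^ (2 * n) = 1 := by
    have := congrArg (fun u : (𝓞 K)ˣ => φ ((u : 𝓞 K) : K)) hη
    simpa using this
  have hnorm := Complex.norm_eq_one_of_pow_eq_one hηC (by lia)
  have hφs : φ s ^ 2 = ((Real.sqrt m : ℝ) : ℂ) ^ 2 := by
    rw [← map_pow, hs, map_intCast, ← Complex.ofReal_pow, Real.sq_sqrt (by exact_mod_cast (by lia : 0 ≤ m))]
    simp
  obtain ⟨w, hw, hw2⟩ : ∃ w : ℝ, φ s = w ∧ w ^ 2 = m := by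
    have hm0 : (0 : ℝ) ≤ m := by exact_mod_cast (by lia : 0 ≤ m)
    rcases sq_eq_sq_iff_eq_or_eq_neg.1 hφs with h | h
    · exact ⟨_, h, Real.sq_sqrt hm0⟩
    · exact ⟨-Real.sqrt m, by rw [h]; simp, by rw [neg_sq, Real.sq_sqrt hm0]⟩
  have hη' : φ ((η : 𝓞 K) : K) = ((x + y * w : ℝ) : ℂ) := by
    have : ((η : 𝓞 K) : K) = x + y * s := by
      change ((x + y * S : 𝓞 K) : K) = _
      push_cast
      rfl
    rw [this]
    push_cast
    rw [map_add, map_mul, map_intCast, map_intCast, hw]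
  rw [hη', Complex.norm_real, Real.norm_eq_abs] at hnorm
  have h1 : (x + y * w) ^ 2 = 1 := by rw [← sq_abs, hnorm, one_pow]
  have h2 : (x + y * w) * (x - y * w) = 1 := by
    have h3 : (x : ℝ) ^ 2 - m * y ^ 2 = 1 := by exact_mod_cast congrArg (Int.cast (R := ℝ)) hxy
    linear_combination h3 - (y : ℝ) ^ 2 * hw2
  have h0 : (x + y * w : ℝ) ≠ 0 := left_ne_zero_of_mul_eq_one h2
  have h3 : x + y * w = x - y * w := mul_left_cancel₀ h0 (by rw [h2, ← h1]; ring)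
  have h4 : (y : ℝ) * w = 0 := by linarith
  rcases mul_eq_zero.1 h4 with h | h
  · exact hy (by exact_mod_cast h)
  · rw [h] at hw2
    have : (m : ℝ) = 0 := by rw [← hw2]; norm_num
    have : m = 0 := by exact_mod_cast this
    lia

/-- `η ^ (2 N) - η ^ (-2 N)` is a rational multiple of `√m`. -/
lemma exists_sq_pow_sub_inv_pow_eq (hm : Squarefree m) (hm1 : 1 < m) (hs : s ^ 2 = m)
    (hK : IntermediateField.adjoin ℚ {s} = ⊤) (η : (𝓞 K)ˣ) (N : ℕ) :
    ∃ b : ℚ, (((η : 𝓞 K) : K) ^ 2) ^ N - ((((η : 𝓞 K) : K) ^ 2)⁻¹) ^ N = b * s := by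
  obtain ⟨a, b, hab⟩ := exists_eq_add_mul_sqrt hm hm1 hs hK ((((η : 𝓞 K) : K) ^ 2) ^ N)
  -- A unit has norm ±1; squaring makes it 1, so that inversion becomes conjugation and the rational
  -- parts cancel.
  have hn : Algebra.norm ℚ ((η : 𝓞 K) : K) ^ 2 = 1 := by
    have := isUnit_iff_norm.1 η.isUnit
    rw [RingOfIntegers.coe_norm] at this
    rw [← sq_abs, this, one_pow]
  have h1 : a ^ 2 - b ^ 2 * m = 1 := by
    rw [← norm_add_mul_sqrt hm hm1 hs hK, ← hab, map_pow, map_pow, hn, one_pow]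
  have h2 : ((a : K) + b * s) * (a - b * s) = 1 := by
    have h3 : (a : K) ^ 2 - b ^ 2 * m = 1 := by exact_mod_cast congrArg (Rat.cast (K := K)) h1
    linear_combination h3 - (b : K) ^ 2 * hs
  refine ⟨2 * b, ?_⟩
  rw [inv_pow, hab, inv_eq_of_mul_eq_one_right h2]
  push_cast
  ring

end Units

/-! ### The regulator as a quotient on the line ℚ_p √m -/

section Regulator

variable {K : Type*} [Field K] [NumberField K] {p : ℕ}

/-- If `𝔭` is the only prime above `p`, then `∏_{𝔮 ∣ p} K_𝔮` is `K_𝔭`. -/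
noncomputable def localAlgebraEquiv {𝔭 : HeightOneSpectrum (𝓞 K)} (h𝔭 : (p : 𝓞 K) ∈ 𝔭.asIdeal)
    (huniq : ∀ 𝔮 : HeightOneSpectrum (𝓞 K), (p : 𝓞 K) ∈ 𝔮.asIdeal → 𝔮 = 𝔭) :
    LocalAlgebra K p ≃L[ℤ] 𝔭.adicCompletion K :=
  letI : Unique (PrimesAbove K p) := ⟨⟨⟨𝔭, h𝔭⟩⟩, fun 𝔮 => Subtype.ext (huniq _ 𝔮.2)⟩
  ContinuousLinearEquiv.piUnique ℤ fun 𝔮 : PrimesAbove K p => 𝔮.1.adicCompletion K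

/-- The image in `K_𝔭` of the global units congruent to `1` modulo `𝔭`. -/
def localGlobalUnits (𝔭 : HeightOneSpectrum (𝓞 K)) : Set (𝔭.adicCompletion K) :=
  {x | ∃ e : (𝓞 K)ˣ, (e : 𝓞 K) - 1 ∈ 𝔭.asIdeal ∧
    x = algebraMap K (𝔭.adicCompletion K) ((e : 𝓞 K) : K)}

variable {𝔭 : HeightOneSpectrum (𝓞 K)}

lemma forall_primesAbove_iff (h𝔭 : (p : 𝓞 K) ∈ 𝔭.asIdeal)
    (huniq : ∀ 𝔮 : HeightOneSpectrum (𝓞 K), (p : 𝓞 K) ∈ 𝔮.asIdeal → 𝔮 = 𝔭)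
    {P : PrimesAbove K p → Prop} : (∀ 𝔮, P 𝔮) ↔ P ⟨𝔭, h𝔭⟩ := by
  refine ⟨fun h => h _, fun h 𝔮 => ?_⟩
  have : 𝔮 = ⟨𝔭, h𝔭⟩ := Subtype.ext (huniq _ 𝔮.2)
  rwa [this]

lemma mem_logMap_image_principalUnits_iff (h𝔭 : (p : 𝓞 K) ∈ 𝔭.asIdeal)
    (huniq : ∀ 𝔮 : HeightOneSpectrum (𝓞 K), (p : 𝓞 K) ∈ 𝔮.asIdeal → 𝔮 = 𝔭)
    (T : Set (LocalAlgebra K p)) (x : LocalAlgebra K p) :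
    x ∈ logMap K p '' T ↔
      localAlgebraEquiv h𝔭 huniq x ∈ logSeries '' (localAlgebraEquiv h𝔭 huniq '' T) := by
  constructor
  · rintro ⟨u, hu, rfl⟩
    exact ⟨_, ⟨u, hu, rfl⟩, rfl⟩
  · rintro ⟨_, ⟨u, hu, rfl⟩, h⟩
    exact ⟨u, hu, (localAlgebraEquiv h𝔭 huniq).injective h⟩

lemma image_principalUnits (h𝔭 : (p : 𝓞 K) ∈ 𝔭.asIdeal)
    (huniq : ∀ 𝔮 : HeightOneSpectrum (𝓞 K), (p : 𝓞 K) ∈ 𝔮.asIdeal → 𝔮 = 𝔭) :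
    localAlgebraEquiv h𝔭 huniq '' principalUnits K p = unitDisc (𝔭.adicCompletion K) := by
  ext y
  constructor
  · rintro ⟨u, hu, rfl⟩
    exact (norm_lt_one_iff_valued_lt_one 𝔭).2 (hu ⟨𝔭, h𝔭⟩)
  · intro hy
    obtain ⟨u, rfl⟩ := (localAlgebraEquiv h𝔭 huniq).surjective y
    exact ⟨u, (forall_primesAbove_iff h𝔭 huniq).2 ((norm_lt_one_iff_valued_lt_one 𝔭).1 hy), rfl⟩

lemma image_globalUnitsClosure (h𝔭 : (p : 𝓞 K) ∈ 𝔭.asIdeal)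
    (huniq : ∀ 𝔮 : HeightOneSpectrum (𝓞 K), (p : 𝓞 K) ∈ 𝔮.asIdeal → 𝔮 = 𝔭) :
    localAlgebraEquiv h𝔭 huniq '' globalUnitsClosure K p = closure (localGlobalUnits 𝔭) := by
  rw [globalUnitsClosure]
  have h := (localAlgebraEquiv h𝔭 huniq).toHomeomorph.image_closure
    (diagonal K p '' principalGlobalUnits K p)
  refine h.trans (congrArg closure ?_)
  ext y
  constructor
  · rintro ⟨_, ⟨e, he, rfl⟩, rfl⟩
    exact ⟨e, he ⟨𝔭, h𝔭⟩, rfl⟩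
  · rintro ⟨e, he, rfl⟩
    exact ⟨_, ⟨e, (forall_primesAbove_iff h𝔭 huniq).2 he, rfl⟩, rfl⟩

variable [Fact p.Prime]

/-- By additivity the image of the logarithm is already a group, so generating a subgroup adds
nothing. -/
lemma mem_logUnits_iff (hL : IsRamifiedQuadratic p (𝔭.adicCompletion K))
    (h𝔭 : (p : 𝓞 K) ∈ 𝔭.asIdeal)
    (huniq : ∀ 𝔮 : HeightOneSpectrum (𝓞 K), (p : 𝓞 K) ∈ 𝔮.asIdeal → 𝔮 = 𝔭)
    (x : LocalAlgebra K p) :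
    x ∈ logUnits K p ↔
      localAlgebraEquiv h𝔭 huniq x ∈ logSeries '' unitDisc (𝔭.adicCompletion K) := by
  let G : AddSubgroup (𝔭.adicCompletion K) :=
    { carrier := logSeries '' unitDisc (𝔭.adicCompletion K)
      zero_mem' := ⟨1, by simp [unitDisc], logSeries_one⟩
      add_mem' := by
        rintro _ _ ⟨u, hu, rfl⟩ ⟨v, hv, rfl⟩
        exact ⟨u * v, norm_mul_sub_one_lt hu hv, logSeries_mul hL.norm_prime hu hv⟩
      neg_mem' := by
        rintro _ ⟨u, hu, rfl⟩
        exact ⟨u⁻¹, norm_inv_sub_one_lt hu, logSeries_inv hL.norm_prime hu⟩ }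
  have h : logMap K p '' principalUnits K p =
      (G.comap (localAlgebraEquiv h𝔭 huniq : LocalAlgebra K p →+ 𝔭.adicCompletion K) :
        Set (LocalAlgebra K p)) := by
    ext y
    rw [mem_logMap_image_principalUnits_iff h𝔭 huniq, image_principalUnits]
    rfl
  rw [logUnits, h, AddSubgroup.closure_eq]
  rfl

lemma mem_logGlobalUnits_iff (hL : IsRamifiedQuadratic p (𝔭.adicCompletion K))
    (h𝔭 : (p : 𝓞 K) ∈ 𝔭.asIdeal)
    (huniq : ∀ 𝔮 : HeightOneSpectrum (𝓞 K), (p : 𝓞 K) ∈ 𝔮.asIdeal → 𝔮 = 𝔭)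
    {l : 𝔭.adicCompletion K} (hl : logSeries '' closure (localGlobalUnits 𝔭) =
      Set.range fun z : ℤ_[p] => padicEmbedding hL.norm_prime z * l) (x : LocalAlgebra K p) :
    x ∈ logGlobalUnits K p ↔
      ∃ z : ℤ_[p], localAlgebraEquiv h𝔭 huniq x = padicEmbedding hL.norm_prime z * l := by
  let f : ℤ_[p] →+ 𝔭.adicCompletion K := (AddMonoidHom.mulRight l).comp
    ((padicEmbedding hL.norm_prime).comp (PadicInt.Coe.ringHom (p := p))).toAddMonoidHom
  have h : logMap K p '' globalUnitsClosure K p =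
      (f.range.comap (localAlgebraEquiv h𝔭 huniq : LocalAlgebra K p →+ 𝔭.adicCompletion K) :
        Set (LocalAlgebra K p)) := by
    ext y
    rw [mem_logMap_image_principalUnits_iff h𝔭 huniq, image_globalUnitsClosure, hl]
    rfl
  rw [logGlobalUnits, h, AddSubgroup.closure_eq]
  exact exists_congr fun z => eq_comm

lemma pow_sub_one_mem_asIdeal (hN : Ideal.absNorm 𝔭.asIdeal = p) (e : (𝓞 K)ˣ) :
    ((e ^ (p - 1) : (𝓞 K)ˣ) : 𝓞 K) - 1 ∈ 𝔭.asIdeal := by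
  have hcard : Nat.card (𝓞 K ⧸ 𝔭.asIdeal) = p := by
    rw [← hN, Ideal.absNorm_apply]; rfl
  have : Finite (𝓞 K ⧸ 𝔭.asIdeal) :=
    Nat.finite_of_card_ne_zero (hcard ▸ Nat.Prime.ne_zero Fact.out)
  have : Fintype (𝓞 K ⧸ 𝔭.asIdeal) := Fintype.ofFinite _
  rw [Nat.card_eq_fintype_card] at hcard
  have := 𝔭.isMaximal
  let _ := Ideal.Quotient.field 𝔭.asIdeal
  have h := FiniteField.pow_card_sub_one_eq_one (Ideal.Quotient.mk 𝔭.asIdeal (e : 𝓞 K))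
    (e.isUnit.map _).ne_zero
  rw [hcard] at h
  rw [← Ideal.Quotient.eq, map_one, ← h, Units.val_pow_eq_pow_val, map_pow]

lemma norm_algebraMap_sub_one_lt {x : 𝓞 K} (hx : x - 1 ∈ 𝔭.asIdeal) :
    ‖algebraMap K (𝔭.adicCompletion K) (x : K) - 1‖ < 1 := by
  have h : algebraMap K (𝔭.adicCompletion K) (x : K) - 1 =
      algebraMap K (𝔭.adicCompletion K) ((x - 1 : 𝓞 K) : K) := by
    rw [show ((x - 1 : 𝓞 K) : K) = (x : K) - 1 from rfl, map_sub, map_one]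
  rw [norm_lt_one_iff_valued_lt_one, h, valued_algebraMap]
  exact (𝔭.valuation_lt_one_iff_mem _).2 hx

lemma not_prime_dvd_sub_one : ¬ p ∣ p - 1 := by
  have h1 : 1 < p := Nat.Prime.one_lt Fact.out
  intro h
  have := Nat.le_of_dvd (by lia) h
  lia

/-- The logarithms of the closure of the global units are the `ℤ_p`-multiples of
`log (ε ^ (p - 1))`. -/
lemma logSeries_image_closure_localGlobalUnits (hL : IsRamifiedQuadratic p (𝔭.adicCompletion K))
    (hN : Ideal.absNorm 𝔭.asIdeal = p) {ρ : ℝ} (hρ : IsLogRadius p (𝔭.adicCompletion K) ρ)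
    {ε : (𝓞 K)ˣ} (hε : IsFundamentalUnit ε) :
    logSeries '' closure (localGlobalUnits 𝔭) = Set.range fun z : ℤ_[p] =>
      padicEmbedding hL.norm_prime z *
        logSeries (algebraMap K (𝔭.adicCompletion K) ((ε : 𝓞 K) : K) ^ (p - 1)) := by
  have hp := hL.norm_prime
  have hx : ‖algebraMap K (𝔭.adicCompletion K) ((ε : 𝓞 K) : K) ^ (p - 1) - 1‖ < 1 := by
    have h := norm_algebraMap_sub_one_lt (pow_sub_one_mem_asIdeal hN ε)
    rw [Units.val_pow_eq_pow_val, RingOfIntegers.coe_eq_algebraMap, map_pow, map_pow] at h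
    exact h
  refine logSeries_image_closure hp hρ ?_ ?_ ?_
  · rintro _ ⟨e, he, rfl⟩
    exact norm_algebraMap_sub_one_lt he
  · intro n
    refine ⟨(ε ^ n) ^ (p - 1), pow_sub_one_mem_asIdeal hN _, ?_⟩
    rw [Units.val_pow_eq_pow_val, Units.val_pow_eq_pow_val, RingOfIntegers.coe_eq_algebraMap,
      RingOfIntegers.coe_eq_algebraMap, map_pow, map_pow, map_pow, map_pow, ← pow_mul, ← pow_mul,
      mul_comm]
  · rintro _ ⟨e, he, rfl⟩
    have hu := norm_algebraMap_sub_one_lt he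
    obtain ⟨n, hn⟩ := hε e
    -- The exponent 2 removes the sign in e = ±εⁿ, and p - 1 makes the powers of ε principal.
    have h1 : e ^ (2 * (p - 1)) = (ε ^ (p - 1)) ^ (2 * n) := by
      have h2 : e ^ 2 = (ε ^ n) ^ 2 := by
        rcases hn with h | h <;> rw [h]
        rw [neg_sq]
      rw [pow_mul, h2, ← pow_mul, ← zpow_natCast, ← zpow_natCast, ← zpow_mul, ← zpow_mul]
      congr 1
      push_cast
      ring
    have h3 : algebraMap K (𝔭.adicCompletion K) ((e : 𝓞 K) : K) ^ (2 * (p - 1)) =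
        (algebraMap K (𝔭.adicCompletion K) ((ε : 𝓞 K) : K) ^ (p - 1)) ^ (2 * n) := by
      let f : (𝓞 K)ˣ →* (𝔭.adicCompletion K)ˣ :=
        Units.map ((algebraMap K (𝔭.adicCompletion K)).comp (algebraMap (𝓞 K) K) : 𝓞 K →* _)
      have h4 := congrArg (fun u => ((f u : (𝔭.adicCompletion K)ˣ) : 𝔭.adicCompletion K)) h1
      simp only [map_pow, map_zpow, Units.val_pow_eq_pow_val, Units.val_zpow_eq_zpow_val] at h4
      exact h4
    have h5 := congrArg logSeries h3
    rw [logSeries_pow hp hu, logSeries_zpow hp hx] at h5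
    have hnorm : ‖((p - 1 : ℕ) : ℚ_[p])‖ = 1 :=
      norm_natCast_eq_one_of_not_dvd Padic.norm_p_lt_one not_prime_dvd_sub_one
    have hp1 : ((p - 1 : ℕ) : 𝔭.adicCompletion K) ≠ 0 := by
      refine Nat.cast_ne_zero.2 fun h => not_prime_dvd_sub_one (p := p) ?_
      rw [h]
      exact dvd_zero p
    -- Dividing by p - 1, a p-adic unit, keeps the coefficient in ℤ_p.
    refine ⟨⟨(n : ℚ_[p]) / ((p - 1 : ℕ) : ℚ_[p]), ?_⟩, ?_⟩
    · rw [norm_div, hnorm, div_one]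
      exact IsUltrametricDist.norm_intCast_le_one _ n
    · change _ = padicEmbedding hp ((n : ℚ_[p]) / ((p - 1 : ℕ) : ℚ_[p])) * _
      rw [map_div₀, map_intCast, map_natCast, div_mul_eq_mul_div, eq_div_iff hp1]
      refine mul_left_cancel₀ (two_ne_zero (α := 𝔭.adicCompletion K)) ?_
      push_cast at h5
      linear_combination h5

/-- The order of the normalized regulator at a totally ramified prime, when the logarithms of the
principal units meet the line `ℚ_p √m` in `ℤ_p k √m`. -/
theorem regulatorOrder_of_lattice {m : ℤ} {s : K} (hm : Squarefree m) (hm1 : 1 < m)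
    (hs : s ^ 2 = m) (hK : IntermediateField.adjoin ℚ {s} = ⊤)
    {ε : (𝓞 K)ˣ} (hε : IsFundamentalUnit ε)
    (hL : IsRamifiedQuadratic p (𝔭.adicCompletion K))
    (hN : Ideal.absNorm 𝔭.asIdeal = p) (h𝔭 : (p : 𝓞 K) ∈ 𝔭.asIdeal)
    (huniq : ∀ 𝔮 : HeightOneSpectrum (𝓞 K), (p : 𝓞 K) ∈ 𝔮.asIdeal → 𝔮 = 𝔭)
    {ρ : ℝ} (hρ : IsLogRadius p (𝔭.adicCompletion K) ρ) {k : 𝔭.adicCompletion K}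
    {k' : ℚ} (hk0 : k' ≠ 0) (hk : (k' : 𝔭.adicCompletion K) = k)
    (hτ : ∀ c : ℚ_[p], padicEmbedding hL.norm_prime c *
        (k * algebraMap K (𝔭.adicCompletion K) s) ∈
      logSeries '' unitDisc (𝔭.adicCompletion K) ↔ ‖c‖ ≤ 1) :
    Finite (NormalizedRegulator K p) ∧ ∃ r : ℕ, regulatorOrder K p = p ^ r ∧
      ‖logSeries (algebraMap K (𝔭.adicCompletion K) ((ε : 𝓞 K) : K) ^ (p - 1))‖ =
        ((p : ℝ)⁻¹ ^ r) ^ 2 * ‖k * algebraMap K (𝔭.adicCompletion K) s‖ := by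
  have hp := hL.norm_prime
  set x : 𝔭.adicCompletion K := algebraMap K (𝔭.adicCompletion K) ((ε : 𝓞 K) : K) with hxdef
  have hx : ‖x ^ (p - 1) - 1‖ < 1 := by
    have h := norm_algebraMap_sub_one_lt (pow_sub_one_mem_asIdeal hN ε)
    rw [Units.val_pow_eq_pow_val, RingOfIntegers.coe_eq_algebraMap, map_pow, map_pow] at h
    exact h
  have hs0 : s ≠ 0 := by
    rintro rfl
    rw [zero_pow two_ne_zero] at hs
    have : m = 0 := by exact_mod_cast hs.symm
    lia
  have hsL : algebraMap K (𝔭.adicCompletion K) s ≠ 0 := (map_ne_zero _).2 hs0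
  have hkL : k ≠ 0 := hk ▸ Rat.cast_ne_zero.2 hk0
  set τ := k * algebraMap K (𝔭.adicCompletion K) s with hτdef
  have hτ0 : τ ≠ 0 := mul_ne_zero hkL hsL
  -- Some p-power of ε^(p-1) lies in the isometry disc; a vanishing logarithm would make it 1, but ε
  -- has infinite order.
  have hlog0 : logSeries (x ^ (p - 1)) ≠ 0 := by
    intro h0
    obtain ⟨j, hj⟩ := ((Metric.tendsto_nhds.1 (tendsto_pow_prime_pow hp hx)) ρ hρ.pos).exists
    rw [dist_eq_norm_sub] at hj
    have h1 := norm_logSeries hp hρ hj.le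
    rw [add_sub_cancel, logSeries_pow hp hx, h0, mul_zero, norm_zero, eq_comm, norm_eq_zero,
      sub_eq_zero, ← pow_mul] at h1
    refine hε.pow_ne_one hm hm1 hs (n := (p - 1) * p ^ j) ?_ ?_
    · refine mul_ne_zero (fun h => not_prime_dvd_sub_one (p := p) ?_)
        (pow_ne_zero _ (Nat.Prime.ne_zero Fact.out))
      rw [h]
      exact dvd_zero p
    · refine Units.ext (RingOfIntegers.ext ?_)
      refine (algebraMap K (𝔭.adicCompletion K)).injective ?_
      rw [Units.val_pow_eq_pow_val, RingOfIntegers.coe_eq_algebraMap, map_pow, map_pow]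
      refine h1.trans ?_
      simp
  -- The square has norm 1, which places its logarithm on the line ℚ_p √m.
  obtain ⟨c, hc⟩ : ∃ c : ℚ_[p], logSeries ((x ^ (p - 1)) ^ 2) =
      padicEmbedding hp c * algebraMap K (𝔭.adicCompletion K) s := by
    refine exists_logSeries_eq_mul hp (norm_pow_sub_one_lt hx 2) hsL fun N => ?_
    obtain ⟨b, hb⟩ := exists_sq_pow_sub_inv_pow_eq hm hm1 hs hK (ε ^ (p - 1)) N
    refine ⟨b, ?_⟩
    have h := congrArg (algebraMap K (𝔭.adicCompletion K)) hb
    rw [map_sub, map_mul, map_pow, map_pow, map_pow, map_inv₀, map_pow, Units.val_pow_eq_pow_val,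
      RingOfIntegers.coe_eq_algebraMap, map_pow, map_pow, map_ratCast] at h
    exact h
  rw [logSeries_pow hp hx] at hc
  -- The coordinate of log(ε^(p-1)) with respect to τ = k√m; halving undoes the squaring.
  set b : ℚ_[p] := c / 2 / (k' : ℚ_[p]) with hbdef
  have hb : logSeries (x ^ (p - 1)) = padicEmbedding hp b * τ := by
    rw [hbdef, hτdef, map_div₀, map_div₀, map_ofNat, map_ratCast, hk]
    field_simp
    rw [← hc]
    push_cast
    ring
  have hb0 : b ≠ 0 := by
    intro h
    rw [hb, h, map_zero, zero_mul] at hlog0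
    exact hlog0 rfl
  let e := localAlgebraEquiv h𝔭 huniq
  let g : ℚ_[p] →+ LocalAlgebra K p := (e.symm : 𝔭.adicCompletion K →+ LocalAlgebra K p).comp
    ((AddMonoidHom.mulRight τ).comp (padicEmbedding hp).toAddMonoidHom)
  have heg : ∀ c, e (g c) = padicEmbedding hp c * τ := fun c => e.apply_symm_apply _
  have hginj : Function.Injective g := by
    intro a a' h
    have h1 := congrArg e h
    rw [heg, heg] at h1
    exact (padicEmbedding hp).injective (mul_right_cancel₀ hτ0 h1)
  have hM : ∀ y, y ∈ logGlobalUnits K p ↔ ∃ z : ℤ_[p], y = g (z * b) := by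
    intro y
    rw [mem_logGlobalUnits_iff hL h𝔭 huniq
      (logSeries_image_closure_localGlobalUnits hL hN hρ hε)]
    refine exists_congr fun z => ?_
    rw [← e.injective.eq_iff, heg, map_mul, mul_assoc, ← hb]
  have hΛ : ∀ c, g c ∈ logUnits K p ↔ ‖c‖ ≤ 1 := fun c => by
    rw [mem_logUnits_iff hL h𝔭 huniq, ← hτ c]
    exact iff_of_eq (congrArg (· ∈ _) (heg c))
  have hb1 : ‖b‖ ≤ 1 := by
    rw [← hτ b, ← hb]
    exact ⟨_, hx, rfl⟩
  have hMΛ : logGlobalUnits K p ≤ logUnits K p := by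
    intro y hy
    obtain ⟨z, rfl⟩ := (hM y).1 hy
    rw [hΛ, norm_mul]
    exact mul_le_one₀ z.norm_le_one (norm_nonneg _) hb1
  have : IsAddTorsionFree (LocalAlgebra K p) :=
    Function.Injective.isAddTorsionFree (e : LocalAlgebra K p →+ 𝔭.adicCompletion K) e.injective
  obtain ⟨hfin, r, hr, hbr⟩ := card_torsion_quotient g hginj _ _ hb0 hΛ hM hMΛ
  refine ⟨hfin, r, hr, ?_⟩
  rw [hb, norm_mul, norm_padicEmbedding, hbr]

end Regulator

/-! ### From norms to associates and valuations -/

section Assembly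

variable {K : Type*} [Field K] [NumberField K] {p : ℕ} [Fact p.Prime]
  {𝔭 : HeightOneSpectrum (𝓞 K)}

lemma padicAssociated_of_norm_eq {a b : 𝔭.adicCompletion K} (hb : b ≠ 0) (h : ‖a‖ = ‖b‖) :
    PadicAssociated 𝔭 a b := by
  have hb' : ‖b‖ ≠ 0 := norm_ne_zero_iff.2 hb
  have h1 : ‖a / b‖ = 1 := by rw [norm_div, h, div_self hb']
  have h2 : Valued.v (a / b) = 1 := by
    have h3 : ∀ x : 𝔭.adicCompletion K, ‖x‖ = 1 → Valued.v x ≤ 1 := by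
      intro x hx
      by_contra! hlt
      have h4 : Valued.v x⁻¹ < 1 := by
        rw [map_inv₀]
        exact inv_lt_one_of_one_lt₀ hlt
      rw [← norm_lt_one_iff_valued_lt_one, norm_inv, hx, inv_one] at h4
      exact lt_irrefl _ h4
    refine le_antisymm (h3 _ h1) (not_lt.1 fun hlt => ?_)
    rw [← norm_lt_one_iff_valued_lt_one, h1] at hlt
    exact lt_irrefl _ hlt
  have hmem : a / b ∈ 𝔭.adicCompletionIntegers K :=
    (HeightOneSpectrum.mem_adicCompletionIntegers (𝓞 K) K 𝔭).2 h2.le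
  obtain ⟨u, hu⟩ := (HeightOneSpectrum.adicCompletionIntegers.isUnit_iff_valued_eq_one
    (a := (⟨a / b, hmem⟩ : 𝔭.adicCompletionIntegers K))).2 h2
  exact ⟨u, by rw [hu, div_mul_cancel₀ _ hb]⟩

lemma hasOrd_of_norm_eq (hN : Ideal.absNorm 𝔭.asIdeal = p) {x : K} {n : ℕ}
    (h : ‖algebraMap K (𝔭.adicCompletion K) x‖ = (p : ℝ)⁻¹ ^ n) : HasOrd 𝔭 x n := by
  have hp1 : (1 : ℝ) < p := Nat.one_lt_cast.2 (Nat.Prime.one_lt Fact.out)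
  have h0 : algebraMap K (𝔭.adicCompletion K) x ≠ 0 := by
    rw [← norm_ne_zero_iff, h]
    exact (pow_pos inv_prime_pos n).ne'
  have hv : Valued.v (algebraMap K (𝔭.adicCompletion K) x) ≠ 0 := (Valuation.ne_zero_iff _).2 h0
  rw [norm_eq_zpow_of_valued_eq 𝔭 (WithZero.exp_log hv).symm, hN, inv_pow, ← zpow_natCast,
    ← zpow_neg] at h
  have h1 := zpow_right_injective₀ (by positivity) hp1.ne' h
  rw [HasOrd, ← valued_algebraMap, ← h1, WithZero.exp_log hv]

lemma norm_natCast_sub_one (hp : ‖(p : 𝔭.adicCompletion K)‖ = (p : ℝ)⁻¹ ^ 2) :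
    ‖((p - 1 : ℕ) : 𝔭.adicCompletion K)‖ = 1 :=
  norm_natCast_eq_one_of_not_dvd (norm_prime_lt_one hp) not_prime_dvd_sub_one

lemma norm_unitLog (hp : ‖(p : 𝔭.adicCompletion K)‖ = (p : ℝ)⁻¹ ^ 2)
    (hN : Ideal.absNorm 𝔭.asIdeal = p) (x : 𝔭.adicCompletion K) :
    ‖unitLog 𝔭 x‖ = ‖logSeries (x ^ (p - 1))‖ := by
  rw [unitLog, hN, norm_div, norm_natCast_sub_one hp, div_one]
  rfl

variable {m : ℤ} {s : K}

lemma ramification_data (hm : Squarefree m) (hm1 : 1 < m) (hs : s ^ 2 = m)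
    (hK : IntermediateField.adjoin ℚ {s} = ⊤) (hpD : (p : ℤ) ∣ NumberField.discr K)
    (h𝔭 : (p : 𝓞 K) ∈ 𝔭.asIdeal) :
    Ideal.absNorm 𝔭.asIdeal = p ∧ IsRamifiedQuadratic p (𝔭.adicCompletion K) ∧
      (∀ 𝔮 : HeightOneSpectrum (𝓞 K), (p : 𝓞 K) ∈ 𝔮.asIdeal → 𝔮 = 𝔭) ∧
      ‖algebraMap K (𝔭.adicCompletion K) s - (if (p : ℤ) ∣ m then 0 else 1)‖ = (p : ℝ)⁻¹ := by
  have hp : p.Prime := Fact.out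
  let S : 𝓞 K := ⟨s, isIntegral_sqrt hs⟩
  have hS : S ^ 2 = (m : 𝓞 K) := RingOfIntegers.ext (by
    change s ^ 2 = ((m : 𝓞 K) : K)
    rw [hs]
    simp)
  obtain ⟨u, hu, hπ⟩ := exists_sq_eq_mul hm hS hp (dvd_or_of_dvd_discr hm hm1 hs hK hp hpD) h𝔭
  obtain ⟨hN, hv, hspan⟩ := absNorm_eq_of_sq (finrank_eq_two hm hm1 hs hK) hp h𝔭 hπ hu
  refine ⟨hN, isRamifiedQuadratic_adicCompletion hp hN hπ hu hv,
    fun 𝔮 h𝔮 => eq_of_mem_of_span_eq_sq hspan h𝔮, ?_⟩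
  have h1 : algebraMap K (𝔭.adicCompletion K) s - (if (p : ℤ) ∣ m then 0 else 1) =
      algebraMap K (𝔭.adicCompletion K)
        (algebraMap (𝓞 K) K (S - if (p : ℤ) ∣ m then 0 else 1)) := by
    rw [map_sub, map_sub]
    split_ifs
    · rw [map_zero, map_zero]
      rfl
    · rw [map_one, map_one]
      rfl
  have h2 := valued_algebraMap 𝔭 (algebraMap (𝓞 K) K (S - if (p : ℤ) ∣ m then 0 else 1))
  rw [HeightOneSpectrum.valuation_of_algebraMap, hv] at h2
  rw [h1, norm_eq_zpow_of_valued_eq 𝔭 h2, hN, zpow_neg_one]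

/-- The order of the normalized regulator in terms of the `p`-adic logarithm and of the order of
`ε ^ ((p - 1) j) - 1` at `𝔭`. -/
theorem regulatorOrder_summary (hm : Squarefree m) (hm1 : 1 < m)
    (hs : s ^ 2 = m) (hK : IntermediateField.adjoin ℚ {s} = ⊤)
    {ε : (𝓞 K)ˣ} (hε : IsFundamentalUnit ε)
    (hL : IsRamifiedQuadratic p (𝔭.adicCompletion K))
    (hN : Ideal.absNorm 𝔭.asIdeal = p) (h𝔭 : (p : 𝓞 K) ∈ 𝔭.asIdeal)
    (huniq : ∀ 𝔮 : HeightOneSpectrum (𝓞 K), (p : 𝓞 K) ∈ 𝔮.asIdeal → 𝔮 = 𝔭)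
    {ρ : ℝ} (hρ : IsLogRadius p (𝔭.adicCompletion K) ρ) {k : 𝔭.adicCompletion K}
    {k' : ℚ} (hk0 : k' ≠ 0) (hk : (k' : 𝔭.adicCompletion K) = k)
    (hτ : ∀ c : ℚ_[p], padicEmbedding hL.norm_prime c *
        (k * algebraMap K (𝔭.adicCompletion K) s) ∈
      logSeries '' unitDisc (𝔭.adicCompletion K) ↔ ‖c‖ ≤ 1)
    {γ : ℕ} (hγ : ‖k * algebraMap K (𝔭.adicCompletion K) s‖ = (p : ℝ)⁻¹ ^ γ)
    {j e : ℕ} (he : ‖(j : 𝔭.adicCompletion K)‖ = (p : ℝ)⁻¹ ^ e)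
    (hj : ∀ y : 𝔭.adicCompletion K, ‖y - 1‖ ≤ (p : ℝ)⁻¹ → ‖y ^ j - 1‖ ≤ ρ) :
    Finite (NormalizedRegulator K p) ∧ ∃ r : ℕ,
      padicValNat p (regulatorOrder K p) = r ∧
      (∀ d : 𝔭.adicCompletion K, ‖d‖ = (p : ℝ)⁻¹ ^ γ →
        PadicAssociated 𝔭 (regulatorOrder K p)
          (unitLog 𝔭 (algebraMap K (𝔭.adicCompletion K) ((ε : 𝓞 K) : K)) / d)) ∧
      HasOrd 𝔭 (((ε : 𝓞 K) : K) ^ ((p - 1) * j) - 1) ((e + 2 * r + γ : ℕ) : ℤ) := by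
  have hp := hL.norm_prime
  have hq := inv_prime_pos (p := p)
  obtain ⟨hfin, r, hr, hlog⟩ :=
    regulatorOrder_of_lattice hm hm1 hs hK hε hL hN h𝔭 huniq hρ hk0 hk hτ
  refine ⟨hfin, r, by rw [hr, padicValNat.prime_pow], fun d hd => ?_, ?_⟩
  · have hd0 : d ≠ 0 := by
      rw [← norm_ne_zero_iff, hd]
      exact (pow_pos hq γ).ne'
    -- Only the norm of the divisor d matters, so k√m may be replaced by any associate.
    have hnorm : ‖unitLog 𝔭 (algebraMap K (𝔭.adicCompletion K) ((ε : 𝓞 K) : K)) / d‖ =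
        ((p : ℝ)⁻¹ ^ r) ^ 2 := by
      rw [norm_div, norm_unitLog hp hN, hlog, hγ, hd, mul_div_assoc,
        div_self (pow_pos hq γ).ne', mul_one]
    refine padicAssociated_of_norm_eq ?_ ?_
    · rw [← norm_ne_zero_iff, hnorm]
      exact (pow_pos (pow_pos hq r) 2).ne'
    · rw [hnorm, hr, Nat.cast_pow, norm_pow, hp, ← pow_mul, ← pow_mul, mul_comm]
  · refine hasOrd_of_norm_eq hN ?_
    have hx : ‖algebraMap K (𝔭.adicCompletion K) ((ε : 𝓞 K) : K) ^ (p - 1) - 1‖ < 1 := by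
      have h := norm_algebraMap_sub_one_lt (pow_sub_one_mem_asIdeal hN ε)
      rw [Units.val_pow_eq_pow_val, RingOfIntegers.coe_eq_algebraMap, map_pow, map_pow] at h
      exact h
    -- The j-th power enters the disc, where ‖y - 1‖ = ‖log y‖; the exponents of j, b and k√m add
    -- up.
    have h1 := norm_logSeries hp hρ (hj _ (hL.norm_le _ hx))
    rw [add_sub_cancel, logSeries_pow hp hx, norm_mul, he, hlog, hγ, ← pow_mul, ← pow_mul] at h1
    rw [map_sub, map_pow, map_one, ← h1, ← pow_add, ← pow_add]
    congr 1
    ring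

end Assembly

/-! ### The cases p ≥ 5, p = 3 and p = 2 -/

section Cases

variable {K : Type*} [Field K] [NumberField K] {m : ℤ} {s : K} {𝔭 : HeightOneSpectrum (𝓞 K)}

lemma regulatorOrder_of_five_le (hm : Squarefree m) (hm1 : 1 < m) (hs : s ^ 2 = m)
    (hK : IntermediateField.adjoin ℚ {s} = ⊤) {ε : (𝓞 K)ˣ} (hε : IsFundamentalUnit ε)
    {p : ℕ} [Fact p.Prime] (h5 : 5 ≤ p) (hpD : (p : ℤ) ∣ NumberField.discr K)
    (h𝔭 : (p : 𝓞 K) ∈ 𝔭.asIdeal) :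
    Finite (NormalizedRegulator K p) ∧ ∃ r : ℕ,
      padicValNat p (regulatorOrder K p) = r ∧
      PadicAssociated 𝔭 (regulatorOrder K p)
        (unitLog 𝔭 (algebraMap K (𝔭.adicCompletion K) ((ε : 𝓞 K) : K)) /
          algebraMap K (𝔭.adicCompletion K) s) ∧
      HasOrd 𝔭 (((ε : 𝓞 K) : K) ^ (p - 1) - 1) (1 + 2 * r) := by
  obtain ⟨hN, hL, huniq, hπ⟩ := ramification_data hm hm1 hs hK hpD h𝔭
  have hpm : (p : ℤ) ∣ m :=
    (dvd_or_of_dvd_discr hm hm1 hs hK Fact.out hpD).resolve_right (by lia)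
  rw [if_pos hpm, sub_zero] at hπ
  obtain ⟨hfin, r, hr, h1, h2⟩ := regulatorOrder_summary hm hm1 hs hK hε hL hN h𝔭 huniq
    (isLogRadius_of_five_le hL.norm_prime h5) (k' := 1) (k := 1) one_ne_zero (by simp)
    (fun c => by rw [one_mul]; exact logSeries_image_of_five_le hL h5 hπ c)
    (γ := 1) (by rw [one_mul, hπ, pow_one]) (j := 1) (e := 0) (by simp)
    (fun y hy => by simpa using hy)
  refine ⟨hfin, r, hr, h1 _ (by rw [hπ, pow_one]), ?_⟩
  rw [mul_one] at h2
  convert h2 using 1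
  push_cast
  ring

lemma regulatorOrder_three (hm : Squarefree m) (hm1 : 1 < m) (hs : s ^ 2 = m)
    (hK : IntermediateField.adjoin ℚ {s} = ⊤) {ε : (𝓞 K)ˣ} (hε : IsFundamentalUnit ε)
    (hpD : ((3 : ℕ) : ℤ) ∣ NumberField.discr K) (h𝔭 : ((3 : ℕ) : 𝓞 K) ∈ 𝔭.asIdeal) :
    Finite (NormalizedRegulator K 3) ∧ ∃ r : ℕ,
      padicValNat 3 (regulatorOrder K 3) = r ∧
      ((m % 9 = 3 ∧ PadicAssociated 𝔭 (regulatorOrder K 3)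
        (unitLog 𝔭 (algebraMap K (𝔭.adicCompletion K) ((ε : 𝓞 K) : K)) /
          algebraMap K (𝔭.adicCompletion K) s) ∧
        HasOrd 𝔭 (((ε : 𝓞 K) : K) ^ 6 - 1) (2 * r + 3)) ∨
      (m % 9 = 6 ∧ PadicAssociated 𝔭 (regulatorOrder K 3)
        (unitLog 𝔭 (algebraMap K (𝔭.adicCompletion K) ((ε : 𝓞 K) : K)) /
          (3 * algebraMap K (𝔭.adicCompletion K) s)) ∧
        HasOrd 𝔭 (((ε : 𝓞 K) : K) ^ 6 - 1) (2 * r + 5))) := by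
  have : Fact (Nat.Prime 3) := ⟨Nat.prime_three⟩
  obtain ⟨hN, hL, huniq, hπ⟩ := ramification_data hm hm1 hs hK hpD h𝔭
  have hpm : ((3 : ℕ) : ℤ) ∣ m :=
    (dvd_or_of_dvd_discr hm hm1 hs hK Fact.out hpD).resolve_right (by lia)
  rw [if_pos hpm, sub_zero] at hπ
  have hs2 : algebraMap K (𝔭.adicCompletion K) s ^ 2 = m := by rw [← map_pow, hs, map_intCast]
  have h3 : ‖(3 : 𝔭.adicCompletion K)‖ = ((3 : ℕ) : ℝ)⁻¹ ^ 2 := by exact_mod_cast hL.norm_prime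
  have hj : ∀ y : 𝔭.adicCompletion K, ‖y - 1‖ ≤ ((3 : ℕ) : ℝ)⁻¹ →
      ‖y ^ 3 - 1‖ ≤ ((3 : ℕ) : ℝ)⁻¹ ^ 2 := by
    intro y hy
    have h4 : y ^ 3 - 1 = ((3 : ℤ) : 𝔭.adicCompletion K) * ((y - 1) * y) + (y - 1) ^ 3 := by
      push_cast; ring
    have hy1 : ‖y‖ = 1 := norm_eq_one_of_norm_sub_one_lt (hy.trans_lt inv_prime_lt_one)
    have hq := inv_prime_pos (p := 3)
    have hq1 := inv_prime_lt_one (p := 3)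
    rw [h4]
    refine norm_add_le_of_le ?_ ?_
    · rw [norm_mul, norm_mul, hy1, mul_one, Int.cast_ofNat, h3]
      exact mul_le_of_le_one_right (by positivity) (hy.trans hq1.le)
    · rw [norm_pow]
      calc ‖y - 1‖ ^ 3 ≤ ((3 : ℕ) : ℝ)⁻¹ ^ 3 := by gcongr
        _ ≤ _ := pow_le_pow_of_le_one hq.le hq1.le (by norm_num)
  -- Squarefreeness excludes 9 ∣ m.
  have hm9 : m % 9 = 3 ∨ m % 9 = 6 := by
    have h9 : ¬ (9 : ℤ) ∣ m := fun h => by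
      have := Int.isUnit_iff.1 (hm 3 (by simpa using h))
      lia
    lia
  rcases hm9 with h9 | h9
  · obtain ⟨hfin, r, hr, h1, h2⟩ := regulatorOrder_summary hm hm1 hs hK hε hL hN h𝔭 huniq
      (isLogRadius_three hL.norm_prime) (k' := 1) (k := 1) one_ne_zero (by simp)
      (fun c => by
        rw [one_mul]; exact logSeries_image_three_of_mod_nine_eq_three hL hs2 hπ h9 c)
      (γ := 1) (by rw [one_mul, hπ, pow_one]) (j := 3) (e := 2) hL.norm_prime hj
    refine ⟨hfin, r, hr, Or.inl ⟨h9, h1 _ (by rw [hπ, pow_one]), ?_⟩⟩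
    convert h2 using 1
    push_cast
    ring
  · obtain ⟨hfin, r, hr, h1, h2⟩ := regulatorOrder_summary hm hm1 hs hK hε hL hN h𝔭 huniq
      (isLogRadius_three hL.norm_prime) (k' := 3) (k := 3) three_ne_zero (by simp)
      (logSeries_image_three_of_mod_nine_eq_six hL hs2 hπ h9)
      (γ := 3) (by rw [norm_mul, hπ, h3]; ring) (j := 3) (e := 2) hL.norm_prime hj
    refine ⟨hfin, r, hr, Or.inr ⟨h9, h1 _ (by rw [norm_mul, hπ, h3]; ring), ?_⟩⟩
    convert h2 using 1
    push_cast
    ring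

/-- Here γ is the valuation of k√m. Keeping it with the norm of √m lets the four congruences share
one form. -/
lemma regulatorOrder_two (hm : Squarefree m) (hm1 : 1 < m) (hs : s ^ 2 = m)
    (hK : IntermediateField.adjoin ℚ {s} = ⊤) {ε : (𝓞 K)ˣ} (hε : IsFundamentalUnit ε)
    (hpD : ((2 : ℕ) : ℤ) ∣ NumberField.discr K) (h𝔭 : ((2 : ℕ) : 𝓞 K) ∈ 𝔭.asIdeal) :
    Finite (NormalizedRegulator K 2) ∧ ∃ r : ℕ,
      padicValNat 2 (regulatorOrder K 2) = r ∧ ∃ γ : ℕ,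
      (∀ d : 𝔭.adicCompletion K, ‖d‖ = ((2 : ℕ) : ℝ)⁻¹ ^ γ →
        PadicAssociated 𝔭 (regulatorOrder K 2)
          (unitLog 𝔭 (algebraMap K (𝔭.adicCompletion K) ((ε : 𝓞 K) : K)) / d)) ∧
      HasOrd 𝔭 (((ε : 𝓞 K) : K) ^ 4 - 1) ((4 + 2 * r + γ : ℕ) : ℤ) ∧
      ‖(2 : 𝔭.adicCompletion K)‖ = ((2 : ℕ) : ℝ)⁻¹ ^ 2 ∧
      ((m % 8 = 2 ∧ γ = 1 ∧ ‖algebraMap K (𝔭.adicCompletion K) s‖ = ((2 : ℕ) : ℝ)⁻¹) ∨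
        (m % 8 = 3 ∧ γ = 2 ∧ ‖algebraMap K (𝔭.adicCompletion K) s‖ = 1) ∨
        (m % 8 = 6 ∧ γ = 3 ∧ ‖algebraMap K (𝔭.adicCompletion K) s‖ = ((2 : ℕ) : ℝ)⁻¹) ∨
        (m % 8 = 7 ∧ γ = 4 ∧ ‖algebraMap K (𝔭.adicCompletion K) s‖ = 1)) := by
  have : Fact (Nat.Prime 2) := ⟨Nat.prime_two⟩
  obtain ⟨hN, hL, huniq, hπ⟩ := ramification_data hm hm1 hs hK hpD h𝔭
  have hs2 : algebraMap K (𝔭.adicCompletion K) s ^ 2 = m := by rw [← map_pow, hs, map_intCast]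
  have h2 : ‖(2 : 𝔭.adicCompletion K)‖ = ((2 : ℕ) : ℝ)⁻¹ ^ 2 := by exact_mod_cast hL.norm_prime
  have h4 : ‖(4 : 𝔭.adicCompletion K)‖ = ((2 : ℕ) : ℝ)⁻¹ ^ 4 := by
    have : (4 : 𝔭.adicCompletion K) = 2 * 2 := by norm_num
    rw [this, norm_mul, h2]
    ring
  have h4' : ‖((4 : ℕ) : 𝔭.adicCompletion K)‖ = ((2 : ℕ) : ℝ)⁻¹ ^ 4 := by exact_mod_cast h4
  have hq := inv_prime_pos (p := 2)
  have hq1 := inv_prime_lt_one (p := 2)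
  have hj : ∀ y : 𝔭.adicCompletion K, ‖y - 1‖ ≤ ((2 : ℕ) : ℝ)⁻¹ →
      ‖y ^ 4 - 1‖ ≤ ((2 : ℕ) : ℝ)⁻¹ ^ 3 := by
    intro y hy
    -- This is (y² - 1)(y² + 1) in terms of y - 1; each factor has norm at most 1/4.
    have h5 : y ^ 4 - 1 = ((y - 1) * (y - 1 + 2)) * ((y - 1) * (y - 1 + 2) + 2) := by ring
    have h6 : ‖(2 : 𝔭.adicCompletion K)‖ ≤ ((2 : ℕ) : ℝ)⁻¹ := by
      rw [h2]; exact pow_le_of_le_one hq.le hq1.le two_ne_zero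
    have h7 : ‖(y - 1) * (y - 1 + 2)‖ ≤ ((2 : ℕ) : ℝ)⁻¹ ^ 2 := by
      rw [norm_mul, sq]
      have := norm_add_le_of_le hy h6
      gcongr
    have h8 := norm_add_le_of_le h7 h2.le
    rw [h5, norm_mul]
    calc _ ≤ ((2 : ℕ) : ℝ)⁻¹ ^ 2 * ((2 : ℕ) : ℝ)⁻¹ ^ 2 := by gcongr
      _ = ((2 : ℕ) : ℝ)⁻¹ ^ 4 := by ring
      _ ≤ _ := pow_le_pow_of_le_one hq.le hq1.le (by norm_num)
  have hρ := isLogRadius_two hL.norm_prime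
  by_cases hpm : ((2 : ℕ) : ℤ) ∣ m
  · rw [if_pos hpm, sub_zero] at hπ
    have hm8 : m % 8 = 2 ∨ m % 8 = 6 := by
      have h8 : ¬ (4 : ℤ) ∣ m := fun h => by
        have := Int.isUnit_iff.1 (hm 2 (by simpa using h))
        lia
      push_cast at hpm
      lia
    rcases hm8 with h8 | h8
    · obtain ⟨hfin, r, hr, h1, h3⟩ := regulatorOrder_summary hm hm1 hs hK hε hL hN h𝔭 huniq hρ
        (k' := 1) (k := 1) one_ne_zero (by simp)
        (fun c => by
          rw [one_mul]; exact logSeries_image_two_of_mod_eight_eq_two hL hs2 hπ h8 c)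
        (γ := 1) (by rw [one_mul, hπ, pow_one]) (j := 4) (e := 4) h4' hj
      exact ⟨hfin, r, hr, 1, h1, h3, h2, Or.inl ⟨h8, rfl, hπ⟩⟩
    · obtain ⟨hfin, r, hr, h1, h3⟩ := regulatorOrder_summary hm hm1 hs hK hε hL hN h𝔭 huniq hρ
        (k' := 2) (k := 2) two_ne_zero (by simp)
        (logSeries_image_two_of_mod_eight_eq_six hL hs2 hπ h8)
        (γ := 3) (by rw [norm_mul, hπ, h2]; ring) (j := 4) (e := 4) h4' hj
      exact ⟨hfin, r, hr, 3, h1, h3, h2, Or.inr (Or.inr (Or.inl ⟨h8, rfl, hπ⟩))⟩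
  · have hm4 := ((dvd_or_of_dvd_discr hm hm1 hs hK Fact.out hpD).resolve_left hpm).2
    rw [if_neg hpm] at hπ
    have hs1 : ‖algebraMap K (𝔭.adicCompletion K) s‖ = 1 :=
      norm_eq_one_of_norm_sub_one_lt (hπ.trans_lt hq1)
    have hm8 : m % 8 = 3 ∨ m % 8 = 7 := by lia
    rcases hm8 with h8 | h8
    · obtain ⟨hfin, r, hr, h1, h3⟩ := regulatorOrder_summary hm hm1 hs hK hε hL hN h𝔭 huniq hρ
        (k' := 2) (k := 2) two_ne_zero (by simp)
        (logSeries_image_two_of_mod_eight_eq_three hL hs2 hπ h8)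
        (γ := 2) (by rw [norm_mul, hs1, h2]; ring) (j := 4) (e := 4) h4' hj
      exact ⟨hfin, r, hr, 2, h1, h3, h2, Or.inr (Or.inl ⟨h8, rfl, hs1⟩)⟩
    · obtain ⟨hfin, r, hr, h1, h3⟩ := regulatorOrder_summary hm hm1 hs hK hε hL hN h𝔭 huniq hρ
        (k' := 4) (k := 4) four_ne_zero (by simp)
        (logSeries_image_two_of_mod_eight_eq_seven hL hs2 hπ h8)
        (γ := 4) (by rw [norm_mul, hs1, h4]; ring) (j := 4) (e := 4) h4' hj
      exact ⟨hfin, r, hr, 4, h1, h3, h2, Or.inr (Or.inr (Or.inr ⟨h8, rfl, hs1⟩))⟩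

lemma exists_heightOneSpectrum_mem {p : ℕ} (hp : p.Prime) :
    ∃ 𝔭 : HeightOneSpectrum (𝓞 K), (p : 𝓞 K) ∈ 𝔭.asIdeal := by
  have hp0 : (p : 𝓞 K) ≠ 0 := Nat.cast_ne_zero.2 hp.ne_zero
  have hne : Ideal.span {(p : 𝓞 K)} ≠ ⊤ := by
    intro h
    have h1 := Ideal.absNorm_eq_one_iff.2 h
    rw [Ideal.absNorm_span_singleton] at h1
    have h2 := Algebra.norm_algebraMap_of_basis (RingOfIntegers.basis K) (p : ℤ)
    rw [map_natCast] at h2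
    rw [h2, Int.natAbs_pow, Int.natAbs_natCast, ← Module.finrank_eq_card_chooseBasisIndex,
      RingOfIntegers.rank] at h1
    exact hp.ne_one
      ((Nat.pow_eq_one.1 h1).resolve_right (Module.finrank_pos (R := ℚ) (M := K)).ne')
  obtain ⟨M, hM, hle⟩ := Ideal.exists_le_maximal _ hne
  have hmem : (p : 𝓞 K) ∈ M := (Ideal.span_singleton_le_iff_mem _).1 hle
  exact ⟨⟨M, hM.isPrime, fun h => hp0 (by simpa [h] using hmem)⟩, hmem⟩

end Cases

end PadicRegulator

theorem mainTheorem4 {K : Type*} [Field K] [NumberField K]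
    (m : ℤ) (hm : Squarefree m) (hm1 : 1 < m)
    (s : K) (hs : s ^ 2 = (m : K)) (hK : IntermediateField.adjoin ℚ {s} = ⊤)
    (ε : (𝓞 K)ˣ) (hε : PadicRegulator.IsFundamentalUnit ε)
    (p : ℕ) (hp : p.Prime) (hpD : (p : ℤ) ∣ NumberField.discr K) :
    Finite (PadicRegulator.NormalizedRegulator K p) ∧
    ∀ 𝔭 : HeightOneSpectrum (𝓞 K), (p : 𝓞 K) ∈ 𝔭.asIdeal →
      ∀ (R : 𝔭.adicCompletion K) (r : ℚ) (sqrtm logε : 𝔭.adicCompletion K),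
        R = (PadicRegulator.regulatorOrder K p : 𝔭.adicCompletion K) →
        r = (padicValNat p (PadicRegulator.regulatorOrder K p) : ℚ) →
        sqrtm = algebraMap K (𝔭.adicCompletion K) s →
        logε = PadicRegulator.unitLog 𝔭
          (algebraMap K (𝔭.adicCompletion K) ((ε : 𝓞 K) : K)) →
        (¬ p ∣ 6 →
          PadicRegulator.PadicAssociated 𝔭 R (1 / sqrtm * logε) ∧
          ∃ δ : ℕ, PadicRegulator.HasOrd 𝔭 (((ε : 𝓞 K) : K) ^ (p - 1) - 1) (1 + 2 * δ) ∧
            r = δ) ∧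
        (p = 3 →
          (¬ m ≡ -3 [ZMOD 9] →
            PadicRegulator.PadicAssociated 𝔭 R (1 / sqrtm * logε)) ∧
          (m ≡ -3 [ZMOD 9] →
            PadicRegulator.PadicAssociated 𝔭 R (1 / (3 * sqrtm) * logε)) ∧
          ∃ n : ℤ, PadicRegulator.HasOrd 𝔭 (((ε : 𝓞 K) : K) ^ 6 - 1) n ∧
            (¬ m ≡ -3 [ZMOD 9] → r = ((n : ℚ) - 2 - 1) / 2) ∧
            (m ≡ -3 [ZMOD 9] → r = ((n : ℚ) - 2 - 3) / 2)) ∧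
        (p = 2 →
          (m ≡ 2 [ZMOD 8] →
            PadicRegulator.PadicAssociated 𝔭 R (logε / sqrtm)) ∧
          (m ≡ 3 [ZMOD 8] ∨ m ≡ 6 [ZMOD 8] →
            PadicRegulator.PadicAssociated 𝔭 R (logε / (2 * sqrtm))) ∧
          (m ≡ 7 [ZMOD 8] →
            PadicRegulator.PadicAssociated 𝔭 R (logε / 4)) ∧
          ∃ n : ℤ, PadicRegulator.HasOrd 𝔭 (((ε : 𝓞 K) : K) ^ 4 - 1) n ∧
            (m ≡ 2 [ZMOD 8] → r = ((n : ℚ) - 4 - 1) / 2) ∧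
            (m ≡ 3 [ZMOD 8] → r = ((n : ℚ) - 4 - 2) / 2) ∧
            (m ≡ 6 [ZMOD 8] → r = ((n : ℚ) - 4 - 3) / 2) ∧
            (m ≡ 7 [ZMOD 8] → r = ((n : ℚ) - 4 - 4) / 2)) := by
  have hfact : Fact p.Prime := ⟨hp⟩
  have hprime : p = 2 ∨ p = 3 ∨ 5 ≤ p := by
    rcases lt_or_ge p 5 with h | h
    · have := hp.two_le
      interval_cases p
      · exact Or.inl rfl
      · exact Or.inr (Or.inl rfl)
      · norm_num at hp
    · exact Or.inr (Or.inr h)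
  refine ⟨?_, ?_⟩
  -- Finiteness does not refer to a prime above p, so one has to be chosen.
  · obtain ⟨𝔭, h𝔭⟩ := PadicRegulator.exists_heightOneSpectrum_mem (K := K) hp
    rcases hprime with rfl | rfl | h5
    · exact (PadicRegulator.regulatorOrder_two hm hm1 hs hK hε hpD h𝔭).1
    · exact (PadicRegulator.regulatorOrder_three hm hm1 hs hK hε hpD h𝔭).1
    · exact (PadicRegulator.regulatorOrder_of_five_le hm hm1 hs hK hε h5 hpD h𝔭).1
  rintro 𝔭 h𝔭 _ _ _ _ rfl rfl rfl rfl
  rcases hprime with rfl | rfl | h5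
  · obtain ⟨-, r, hr, γ, h1, h2, hn2, h3⟩ :=
      PadicRegulator.regulatorOrder_two hm hm1 hs hK hε hpD h𝔭
    refine ⟨fun h => absurd ⟨3, rfl⟩ h, fun h => by norm_num at h, fun _ => ?_⟩
    rw [hr]
    simp only [Int.ModEq, Int.reduceMod]
    rcases h3 with ⟨h8, rfl, hs1⟩ | ⟨h8, rfl, hs1⟩ | ⟨h8, rfl, hs1⟩ | ⟨h8, rfl, hs1⟩
    all_goals
      refine ⟨fun h => ?_, fun h => ?_, fun h => ?_, _, h2, fun h => ?_, fun h => ?_,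
        fun h => ?_, fun h => ?_⟩
    -- For m ≡ 7 the divisor is 4 instead of 4√m; both have norm 2⁻⁴ because √m is a local unit.
    all_goals first
      | (exfalso; lia)
      | (push_cast; ring1)
      | (refine h1 _ ?_; rw [hs1, pow_one])
      | (refine h1 _ ?_; rw [norm_mul, hs1, hn2]; ring)
      | (refine h1 _ ?_
         rw [show (4 : 𝔭.adicCompletion K) = 2 * 2 by norm_num, norm_mul, hn2]; ring)
  · obtain ⟨-, r, hr, h3⟩ := PadicRegulator.regulatorOrder_three hm hm1 hs hK hε hpD h𝔭
    refine ⟨fun h => absurd ⟨2, rfl⟩ h, fun _ => ?_, fun h => by norm_num at h⟩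
    rw [hr]
    simp only [Int.ModEq, Int.reduceMod, Int.reduceNeg]
    rcases h3 with ⟨h9, h1, h2⟩ | ⟨h9, h1, h2⟩
    · refine ⟨fun _ => ?_, fun h => by lia, _, h2, fun _ => by push_cast; ring, fun h => by lia⟩
      rwa [one_div_mul_eq_div]
    · refine ⟨fun h => by lia, fun _ => ?_, _, h2, fun h => by lia, fun _ => by push_cast; ring⟩
      rwa [one_div_mul_eq_div]
  · obtain ⟨-, r, hr, h1, h2⟩ :=
      PadicRegulator.regulatorOrder_of_five_le hm hm1 hs hK hε h5 hpD h𝔭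
    refine ⟨fun _ => ⟨?_, r, h2, by rw [hr]⟩, fun h => by lia, fun h => by lia⟩
    rwa [one_div_mul_eq_div]
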